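/- For an integer $n\ge 0$ and an integer $x\ge 3$ let $f(x)=f_n(x)=n^{\frac{1}{k}-\frac{2}{2k+1}}$ with $k=\lfloor (x-1)/2\rfloor$, and let $f(\infty)=1$. In the (deterministic) Congested Clique model, the input is a simple graph $G$ on the $n$ nodes $0,\dots,n-1$; every node initially knows $n$, its own identifier and the set of its neighbours in $G$; in each synchronous round every node may send to every node an individual message of $O(\log n)$ bits; local computation is free, and every node eventually halts with an output. The girth $g\in\{3,4,\dots\}\cup\{\infty\}$ of $G$ is the length of a shortest cycle of $G$, and $g=\infty$ if $G$ has no cycle. Then there are absolute constants $B, C, c$ such that for all integers $n\ge 0$ and $\ell\ge 1$ there is a deterministic Congested Clique algorithm on $n$ nodes (which may depend on $n$ and $\ell$, but does not know $g$), with messages of at most $B\lceil\log_2 n\rceil$ bits, such that on every $n$-node graph $G$ whose girth satisfies $g>\ell$, all nodes halt with output $g$ within at most $$C\,(\log n)^{c}\cdot\min\Bigl\{f(g),\ f\bigl(2\lfloor(\ell+1)/2\rfloor+1\bigr)\Bigr\}$$ rounds. In other words, the exact girth is computed in $\tilde O\bigl(\min\{f(g),f(2\lfloor(\ell+1)/2\rfloor+1)\}\bigr)$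 rounds. (For $n = 0, 1$ the algorithm needs no rounds; $\log 0$ is read as $0$.) -/

import Mathlib

/-- A deterministic algorithm in the Congested Clique model on `n` nodes with bandwidth `b`
bits per ordered pair of nodes and round, where every node produces an output in `Out`.
The nodes are identified with `Fin n`; local computation is unrestricted. -/
structure CliqueAlgorithm (n b : ℕ) (Out : Type) where
  /-- The local states of a node. -/
  State : Type
  /-- The initial state of a node, from its identifier and the set of its neighbours in the
  input graph; this is all that a node knows about the input at the start. -/
  init : Fin n → Set (Fin n) → State
  /-- The message of `b` bits (or silence) that a node in a given state sends to a given node. -/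
  send : State → Fin n → Option (Fin b → Bool)
  /-- The new state of a node, from its old state and the messages received from all nodes. -/
  receive : State → (Fin n → Option (Fin b → Bool)) → State
  /-- A node halts as soon as its output is `some a`, and its output is then `a`. -/
  output : State → Option Out

namespace CliqueAlgorithm

variable {n b : ℕ} {Out : Type} (A : CliqueAlgorithm n b Out)

/-- What a node in state `s` puts on its link to node `v`: halted nodes are silent. -/
def message (s : A.State) (v : Fin n) : Option (Fin b → Bool) :=
  match A.output s with
  | some _ => none
  | none => A.send s v

/-- One step of a single node: halted nodes never change their state. -/
def step (s : A.State) (inbox : Fin n → Option (Fin b → Bool)) : A.State :=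
  match A.output s with
  | some _ => s
  | none => A.receive s inbox

/-- `A.run G r v` is the state of node `v` after `r` synchronous rounds of `A` on input `G`. -/
def run (G : SimpleGraph (Fin n)) : ℕ → Fin n → A.State
  | 0, v => A.init v (G.neighborSet v)
  | r + 1, v => A.step (run G r v) (fun u => A.message (run G r u) v)

/-- Within `T` rounds on input `G`, every node has halted with output `a`. -/
def ComputesWithin (G : SimpleGraph (Fin n)) (a : Out) (T : ℕ) : Prop :=
  ∀ v, A.output (A.run G T v) = some a

end CliqueAlgorithm

/-- `f(x) = n ^ (1 / ⌊(x - 1) / 2⌋ - 2 / (2 * ⌊(x - 1) / 2⌋ + 1))` for an integer `x ≥ 3`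
(division of natural numbers rounds down), and `f(∞) = 1 = n ^ 0`. -/
noncomputable def girthRounds (n : ℕ) : ℕ∞ → ℝ
  | ⊤ => 1
  | (x : ℕ) =>
    (n : ℝ) ^ (1 / (((x - 1) / 2 : ℕ) : ℝ) - 2 / (2 * (((x - 1) / 2 : ℕ) : ℝ) + 1))

/-! Let `d` be the number of arcs of `G` (twice the number of edges). The lengths `L` = ℓ + 1, ℓ +
2, … are tested in turn, and the first one that occurs is g, so g need not be known beforehand.
Local computation is free, so a protocol is described only by which inputs each node can tell apart
(`Knows`, `Solves`, `Reach`).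

To test `L`, put p = ⌊n^(1/L)⌋. A tree of partitions of the nodes into p intervals has p^L ≤ n
branches, and each branch gets its own node. Every L-tuple of nodes lies coordinatewise in the parts
of some branch, so a cycle of length `L` is seen by some branch (`egirth_le_iff_seesCycle`). Each
partition is balanced against the degrees and against the earlier parts. Hence, up to factors
polynomial in `L`, a branch contains O(d/p² + n) arcs (`card_branchPair_mul_le`), while an arc lies
in at most L² p^(L-2) branches (`card_branches_of_pair_mul_le`). Deterministic routing
(`exists_reach_route`) then brings all arcs to their branches in about d/(n p²) + 1 rounds, up to
polylogarithmic factors.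

The Moore bound (`arcCount_le_of_lt_egirth`) gives d/n ≤ 2(n^(1/k) + 1) whenever the girth exceeds
2k. For odd L = 2j + 1 and finite g, take k = ⌊(g-1)/2⌋: the cost is governed by n^(1/k - 2/L),
which is at most f(g) because j ≤ k, and at most f(2⌊(ℓ+1)/2⌋ + 1) because ⌊(ℓ+1)/2⌋ ≤ j ≤ k.

For even L the girth of `G` itself may be too small for this bound. But if every graph with `d` arcs
has girth at most `L`, then g = L is already known and nothing is tested. Otherwise some graph with
the same `d` has girth above L = 2j, so d/n = O(n^(1/j)) = O(n^(2/L)) and the test is cheap. By the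
same argument d = O(n) once L > log₂ n, and then all of `G` is collected at every node; this also
limits the number of stages. -/

namespace CliqueAlgorithm

variable {n b : ℕ} {Out : Type}

/-- The states after `r` rounds when node `v` starts in the state `s v`. -/
def runFrom (A : CliqueAlgorithm n b Out) (s : Fin n → A.State) : ℕ → Fin n → A.State
  | 0, v => s v
  | r + 1, v => A.step (runFrom A s r v) (fun u => A.message (runFrom A s r u) v)

theorem run_eq_runFrom (A : CliqueAlgorithm n b Out) (G : SimpleGraph (Fin n)) (r : ℕ) :
    A.run G r = A.runFrom (fun v => A.init v (G.neighborSet v)) r := by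
  induction r with
  | zero => rfl
  | succ r ih => funext v; simp only [run, runFrom, ih]

theorem runFrom_succ (A : CliqueAlgorithm n b Out) (s : Fin n → A.State) (r : ℕ) :
    A.runFrom s (r + 1) = A.runFrom (A.runFrom s 1) r := by
  induction r with
  | zero => rfl
  | succ r ih => funext v; rw [runFrom, ih, runFrom]

end CliqueAlgorithm

/-! ### Protocols as growing knowledge -/

namespace CongestedClique

open Classical

variable {n b : ℕ} {Ω : Type}

/-- On the inputs in `P`, the value of `Y` is determined by a view whose indistinguishability
relation is `s`. -/
def Knows (P : Set Ω) (s : Setoid Ω) {β : Type} (Y : Ω → β) : Prop :=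
  ∀ ⦃G⦄, G ∈ P → ∀ ⦃G'⦄, G' ∈ P → s.r G G' → Y G = Y G'

namespace Knows

variable {P Q : Set Ω} {s s' : Setoid Ω} {β γ δ : Type}

/-- In the order on setoids, `s' ≤ s` means that `s'` separates at least as many inputs: knowledge
grows as the setoid shrinks. -/
theorem mono {Y : Ω → β} (h : Knows P s Y) (hs : s' ≤ s) : Knows P s' Y :=
  fun _ hG _ hG' hr => h hG hG' (hs hr)

theorem anti {Y : Ω → β} (h : Knows P s Y) (hP : Q ⊆ P) : Knows Q s Y :=
  fun _ hG _ hG' hr => h (hP hG) (hP hG') hr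

theorem const (c : β) : Knows P s (fun _ => c) := fun _ _ _ _ _ => rfl

theorem comp {Y : Ω → β} (h : Knows P s Y) (F : β → γ) : Knows P s (fun G => F (Y G)) :=
  fun _ hG _ hG' hr => congrArg F (h hG hG' hr)

theorem comp₂ {Y : Ω → β} {Z : Ω → γ} (h : Knows P s Y) (h' : Knows P s Z) (F : β → γ → δ) :
    Knows P s (fun G => F (Y G) (Z G)) :=
  fun _ hG _ hG' hr => congrArg₂ F (h hG hG' hr) (h' hG hG' hr)

theorem pi {ι : Type} {Y : ι → Ω → β} (h : ∀ i, Knows P s (Y i)) :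
    Knows P s (fun G i => Y i G) :=
  fun _ hG _ hG' hr => funext fun i => h i hG hG' hr

theorem congr {Y Z : Ω → β} (h : Knows P s Y) (hYZ : ∀ G ∈ P, Y G = Z G) : Knows P s Z :=
  fun G hG G' hG' hr => by rw [← hYZ G hG, ← hYZ G' hG']; exact h hG hG' hr

end Knows

/-- Starting from the knowledge `K`, some algorithm makes all nodes halt with output `g G` within
`t G` rounds, on every input `G ∈ P`. -/
def Solves (b : ℕ) {Out : Type} (g : Ω → Out) (P : Set Ω) (K : Fin n → Setoid Ω) (t : Ω → ℕ) :
    Prop :=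
  ∃ (A : CliqueAlgorithm n b Out) (start : Fin n → Ω → A.State),
    (∀ v, Knows P (K v) (start v)) ∧
      ∀ G ∈ P, ∃ T ≤ t G, ∀ v, A.output (A.runFrom (fun v => start v G) T v) = some (g G)

section Rules

variable {Out : Type} {g : Ω → Out} {P : Set Ω} {K K' : Fin n → Setoid Ω} {t t' : Ω → ℕ}

theorem Solves.mono (h : Solves b g P K t) (ht : ∀ G ∈ P, t G ≤ t' G) : Solves b g P K t' := by
  obtain ⟨A, st, h1, h2⟩ := h
  refine ⟨A, st, h1, fun G hG => ?_⟩
  obtain ⟨T, hT, h⟩ := h2 G hG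
  exact ⟨T, hT.trans (ht G hG), h⟩

theorem Solves.done (h : ∀ v, Knows P (K v) g) : Solves b g P K t :=
  ⟨{ State := Option Out
     init := fun _ _ => none
     send := fun _ _ => none
     receive := fun s _ => s
     output := id }, fun _ G => some (g G), fun v => (h v).comp some,
    fun _ _ => ⟨0, Nat.zero_le _, fun _ => rfl⟩⟩

/-- Case distinction on a quantity that all nodes know. -/
theorem Solves.cases {α : Type} (κ : Ω → α) (hκ : ∀ v, Knows P (K v) κ)
    (h : ∀ k, Solves b g (P ∩ {G | κ G = k}) K t) : Solves b g P K t := by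
  choose A st hst hrun using h
  -- The solvers of the cases may have different state types, hence the sigma type. The case is
  -- fixed by the starting state; `none` only fills `init` and does not occur in the runs
  -- considered.
  let B : CliqueAlgorithm n b Out :=
    { State := Option (Σ k, (A k).State)
      init := fun _ _ => none
      send := fun s v => match s with
        | none => none
        | some x => (A x.1).send x.2 v
      receive := fun s inbox => match s with
        | none => none
        | some x => some ⟨x.1, (A x.1).receive x.2 inbox⟩
      output := fun s => match s with
        | none => none
        | some x => (A x.1).output x.2 }
  have hB : ∀ k (s : Fin n → (A k).State) r v,
      B.runFrom (fun v => some ⟨k, s v⟩) r v = some ⟨k, (A k).runFrom s r v⟩ := by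
    intro k s r
    induction r with
    | zero => intro v; rfl
    | succ r ih =>
      intro v
      simp only [CliqueAlgorithm.runFrom, ih, CliqueAlgorithm.step, CliqueAlgorithm.message]
      change (match (A k).output ((A k).runFrom s r v) with | some _ => _ | none => _) = _
      cases (A k).output ((A k).runFrom s r v) <;> rfl
  refine ⟨B, fun v G => some ⟨κ G, st (κ G) v G⟩, fun v G hG G' hG' hr => ?_, fun G hG => ?_⟩
  · have e := hκ v hG hG' hr
    have := hst (κ G) v ⟨hG, rfl⟩ ⟨hG', e.symm⟩ hr
    simp only [this]
    rw [e]
  · obtain ⟨T, hT, h⟩ := hrun (κ G) G ⟨hG, rfl⟩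
    refine ⟨T, hT, fun v => ?_⟩
    rw [hB (κ G) (fun v => st (κ G) v G)]
    exact h v

/-- One round: `u` sends to `v` the value `μ u v`, which `u` knows. -/
theorem Solves.round {M : Type} [Fintype M] (hM : Fintype.card M ≤ 2 ^ b)
    (μ : Fin n → Fin n → Ω → M) (hμ : ∀ u v, Knows P (K u) (μ u v))
    (h : Solves b g P (fun v => K v ⊓ Setoid.ker (fun G u => μ u v G)) t) :
    Solves b g P K (fun G => t G + 1) := by
  obtain ⟨enc⟩ : Nonempty (M ↪ (Fin b → Bool)) :=
    Function.Embedding.nonempty_of_card_le (by simpa using hM)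
  obtain ⟨A, st, hst, hrun⟩ := h
  -- In the first round a node stores its identifier and the set of inputs it cannot exclude. What
  -- it has to send is constant on that set, so any element yields the right message; afterwards any
  -- element compatible with the inbox yields the right starting state for `A`.
  let B : CliqueAlgorithm n b Out :=
    { State := (Fin n × Set Ω) ⊕ A.State
      init := fun v _ => Sum.inl (v, ∅)
      send := fun s v => match s with
        | Sum.inl (u, V) => if h : ∃ G, G ∈ V then some (enc (μ u v h.choose)) else none
        | Sum.inr x => A.send x v
      receive := fun s inbox => match s with
        | Sum.inl (v, V) =>
          if h : ∃ G, G ∈ V ∧ ∀ u, inbox u = some (enc (μ u v G)) then Sum.inr (st v h.choose)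
          else Sum.inl (v, V)
        | Sum.inr x => Sum.inr (A.receive x inbox)
      output := fun s => match s with
        | Sum.inl _ => none
        | Sum.inr x => A.output x }
  have hB : ∀ (s : Fin n → A.State) r v,
      B.runFrom (fun v => Sum.inr (s v)) r v = Sum.inr (A.runFrom s r v) := by
    intro s r
    induction r with
    | zero => intro v; rfl
    | succ r ih =>
      intro v
      simp only [CliqueAlgorithm.runFrom, ih, CliqueAlgorithm.step, CliqueAlgorithm.message]
      change (match A.output (A.runFrom s r v) with | some _ => _ | none => _) = _
      cases A.output (A.runFrom s r v) <;> rfl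
  let start : Fin n → Ω → B.State := fun v G => Sum.inl (v, {G' | G' ∈ P ∧ (K v).r G G'})
  have hstep : ∀ G ∈ P, B.runFrom (fun v => start v G) 1 = fun v => Sum.inr (st v G) := by
    intro G hG
    funext v
    have hsend : ∀ u, B.message (start u G) v = some (enc (μ u v G)) := by
      intro u
      have hex : ∃ G', G' ∈ {G' | G' ∈ P ∧ (K u).r G G'} := ⟨G, hG, (K u).refl G⟩
      change (if h : ∃ G', G' ∈ {G' | G' ∈ P ∧ (K u).r G G'} then
        some (enc (μ u v h.choose)) else none) = _
      rw [dif_pos hex]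
      have := hex.choose_spec
      rw [hμ u v hG this.1 this.2]
    change B.receive (start v G) (fun u => B.message (start u G) v) = _
    simp only [hsend]
    have hex : ∃ G', G' ∈ {G' | G' ∈ P ∧ (K v).r G G'} ∧
        ∀ u, some (enc (μ u v G)) = some (enc (μ u v G')) := ⟨G, ⟨hG, (K v).refl G⟩, fun _ => rfl⟩
    change (if h : ∃ G', G' ∈ {G' | G' ∈ P ∧ (K v).r G G'} ∧
        ∀ u, some (enc (μ u v G)) = some (enc (μ u v G')) then Sum.inr (st v h.choose)
          else Sum.inl (v, _)) = _
    rw [dif_pos hex]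
    have hc := hex.choose_spec
    congr 1
    refine (hst v hG hc.1.1 ⟨hc.1.2, ?_⟩).symm
    funext u
    exact enc.injective (Option.some_injective _ (hc.2 u))
  refine ⟨B, start, fun v G hG G' hG' hr => ?_, fun G hG => ?_⟩
  · have : {G'' | G'' ∈ P ∧ (K v).r G G''} = {G'' | G'' ∈ P ∧ (K v).r G' G''} := by
      ext G''
      exact and_congr_right fun _ => ⟨fun h => (K v).trans ((K v).symm hr) h,
        fun h => (K v).trans hr h⟩
    simp only [start, this]
  · obtain ⟨T, hT, h⟩ := hrun G hG
    refine ⟨T + 1, Nat.succ_le_succ hT, fun v => ?_⟩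
    rw [CliqueAlgorithm.runFrom_succ, hstep G hG, hB (fun v => st v G)]
    exact h v

end Rules

/-- On the inputs in `P`, `k` rounds of communication suffice to pass from the knowledge `K` to
the knowledge `K'`. -/
def Reach (b : ℕ) (P : Set Ω) (k : ℕ) (K K' : Fin n → Setoid Ω) : Prop :=
  (∀ v, K' v ≤ K v) ∧ ∀ {Out : Type} (g : Ω → Out) (t : Ω → ℕ), Solves b g P K' t →
    Solves b g P K (fun G => t G + k)

namespace Reach

variable {P : Set Ω} {K K' K'' : Fin n → Setoid Ω} {k k' : ℕ}

theorem refl : Reach b P 0 K K := ⟨fun _ => le_rfl, fun _ _ h => h⟩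

/-- Since `Reach` quantifies over all continuations, phases compose without any merging of
algorithms. -/
theorem trans (h : Reach b P k K K') (h' : Reach b P k' K' K'') : Reach b P (k + k') K K'' := by
  refine ⟨fun v => (h'.1 v).trans (h.1 v), fun g t hs => ?_⟩
  refine (h.2 g _ (h'.2 g t hs)).mono fun G _ => ?_
  omega

theorem knows {β : Type} {Y : Ω → β} {v : Fin n} (h : Reach b P k K K') (hY : Knows P (K v) Y) :
    Knows P (K' v) Y := hY.mono (h.1 v)

theorem mono (h : Reach b P k K K') (hk : k ≤ k') : Reach b P k' K K' :=
  ⟨h.1, fun g t hs => (h.2 g t hs).mono fun _ _ => Nat.add_le_add_left hk _⟩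

end Reach

/-! ### Direct exchange of messages -/

section Primitives

variable {P : Set Ω} {K : Fin n → Setoid Ω}

/-- In `R` rounds every ordered pair of nodes can exchange `R` messages. -/
theorem exists_reach_rounds {M : Type} [Fintype M] (hM : Fintype.card M ≤ 2 ^ b) (R : ℕ)
    (μ : ℕ → Fin n → Fin n → Ω → M) (hμ : ∀ r < R, ∀ u v, Knows P (K u) (μ r u v)) :
    ∃ K', Reach b P R K K' ∧ ∀ r < R, ∀ u v, Knows P (K' v) (μ r u v) := by
  induction R with
  | zero => exact ⟨K, Reach.refl, fun r hr => absurd hr (Nat.not_lt_zero r)⟩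
  | succ R ih =>
    obtain ⟨K₁, h₁, hK₁⟩ := ih fun r hr => hμ r (hr.trans (Nat.lt_succ_self R))
    refine ⟨fun v => K₁ v ⊓ Setoid.ker (fun G u => μ R u v G), h₁.trans ⟨fun v => inf_le_left,
      fun g t hs => hs.round hM (μ R) fun u v => h₁.knows (hμ R (Nat.lt_succ_self R) u v)⟩, ?_⟩
    intro r hr u v
    rcases Nat.lt_succ_iff_lt_or_eq.mp hr with hr | rfl
    · exact (hK₁ r hr u v).mono inf_le_left
    · exact fun G _ G' _ h => congrFun (h.2 : (fun u => μ r u v G) = fun u => μ r u v G') u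

theorem exists_reach_round {M : Type} [Fintype M] (hM : Fintype.card M ≤ 2 ^ b)
    (μ : Fin n → Fin n → Ω → M) (hμ : ∀ u v, Knows P (K u) (μ u v)) :
    ∃ K', Reach b P 1 K K' ∧ ∀ u v, Knows P (K' v) (μ u v) := by
  obtain ⟨K', h, hK⟩ := exists_reach_rounds hM 1 (fun _ => μ) fun _ _ => hμ
  exact ⟨K', h, hK 0 Nat.zero_lt_one⟩

/-- Exchange of natural numbers below `N`. -/
theorem exists_reach_round_nat {N : ℕ} (hN : N ≤ 2 ^ b)
    (μ : Fin n → Fin n → Ω → ℕ) (hlt : ∀ u v, ∀ G ∈ P, μ u v G < N)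
    (hμ : ∀ u v, Knows P (K u) (μ u v)) :
    ∃ K', Reach b P 1 K K' ∧ ∀ u v, Knows P (K' v) (μ u v) := by
  rcases Nat.eq_zero_or_pos N with rfl | hpos
  · have hP : n = 0 ∨ P = ∅ := by
      rcases Nat.eq_zero_or_pos n with h | h
      · exact Or.inl h
      · refine Or.inr (Set.eq_empty_of_forall_notMem fun G hG => ?_)
        exact absurd (hlt ⟨0, h⟩ ⟨0, h⟩ G hG) (Nat.not_lt_zero _)
    refine ⟨K, Reach.refl.mono (Nat.zero_le 1), fun u v => ?_⟩
    rcases hP with rfl | rfl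
    · exact u.elim0
    · exact fun G hG => absurd hG (Set.notMem_empty G)
  · have : NeZero N := ⟨hpos.ne'⟩
    obtain ⟨K', h, hK⟩ := exists_reach_round (P := P) (K := K) (M := Fin N) (by simpa using hN)
      (fun u v G => Fin.ofNat N (μ u v G)) fun u v => (hμ u v).comp _
    refine ⟨K', h, fun u v => ((hK u v).comp Fin.val).congr fun G hG => ?_⟩
    simp [Fin.ofNat, Nat.mod_eq_of_lt (hlt u v G hG)]

/-- What node `h` holds: the items at position `h` together with their data. -/
def holding {ι δ : Type} (pos : Ω → ι → Option (Fin n)) (data : Ω → ι → δ) (h : Fin n) (G : Ω) :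
    ι → Option δ :=
  fun e => if pos G e = some h then some (data G e) else none

/-- Direct delivery of labelled items: at most `R` items per ordered pair of nodes. -/
theorem exists_reach_deliver {ι δ : Type} [Fintype ι] [Fintype δ]
    (hM : Fintype.card ι * Fintype.card δ + 1 ≤ 2 ^ b) (R : ℕ)
    (pos pos' : Ω → ι → Option (Fin n)) (data : Ω → ι → δ)
    (hpos : ∀ G ∈ P, ∀ e, pos G e = none → pos' G e = none)
    (hK : ∀ h, Knows P (K h) (holding pos (fun G e => (data G e, pos' G e)) h))
    (hR : ∀ G ∈ P, ∀ h q,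
      (Finset.univ.filter fun e => pos G e = some h ∧ pos' G e = some q).card ≤ R) :
    ∃ K', Reach b P R K K' ∧ ∀ q, Knows P (K' q) (holding pos' data q) := by
  let S : Fin n → Fin n → Ω → Finset ι := fun h q G =>
    Finset.univ.filter fun e => pos G e = some h ∧ pos' G e = some q
  -- Round `r` carries the `r`-th item on the list for `q`. The message `none` marks an exhausted
  -- list and accounts for the `+ 1` in `hM`.
  let μ : ℕ → Fin n → Fin n → Ω → Option (ι × δ) := fun r h q G =>
    ((S h q G).toList[r]?).map fun e => (e, data G e)
  have hμ : ∀ r h q, Knows P (K h) (μ r h q) := by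
    intro r h q G hG G' hG' hr
    have hh := hK h hG hG' hr
    have hiff : ∀ e, pos G e = some h ↔ pos G' e = some h := by
      intro e
      have := congrFun hh e
      simp only [holding] at this
      split_ifs at this <;> simp_all
    have hdat : ∀ e, pos G e = some h → data G e = data G' e ∧ pos' G e = pos' G' e := by
      intro e he
      have := congrFun hh e
      simp only [holding, if_pos he, if_pos ((hiff e).1 he), Option.some.injEq,
        Prod.mk.injEq] at this
      exact this
    have hS : S h q G = S h q G' := by
      ext e
      simp only [S, Finset.mem_filter, Finset.mem_univ, true_and]
      constructor
      · rintro ⟨h1, h2⟩; exact ⟨(hiff e).1 h1, (hdat e h1).2 ▸ h2⟩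
      · rintro ⟨h1, h2⟩
        have h1' := (hiff e).2 h1
        exact ⟨h1', by rw [(hdat e h1').2]; exact h2⟩
    simp only [μ]
    rw [← hS]
    rcases hx : (S h q G).toList[r]? with _ | e
    · rfl
    · have he : e ∈ S h q G := Finset.mem_toList.1 (List.mem_of_getElem? hx)
      simp only [Option.map_some]
      rw [(hdat e (by simpa [S] using (Finset.mem_filter.1 he).2.1)).1]
  obtain ⟨K', hre, hK'⟩ := exists_reach_rounds (P := P) (K := K) (M := Option (ι × δ))
    (by simpa using hM) R μ fun r _ => hμ r
  have key : ∀ q G, G ∈ P → ∀ G', G' ∈ P → (K' q).r G G' → ∀ e, pos' G e = some q →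
      pos' G' e = some q ∧ data G e = data G' e := by
    intro q G hG G' hG' hr e he
    obtain ⟨h, hh⟩ : ∃ h, pos G e = some h := by
      rcases hx : pos G e with _ | h
      · rw [hpos G hG e hx] at he; exact absurd he (by simp)
      · exact ⟨h, rfl⟩
    have heS : e ∈ S h q G := by simp [S, hh, he]
    obtain ⟨r, hr', hre'⟩ := List.mem_iff_getElem.1 (Finset.mem_toList.2 heS)
    have hrR : r < R := by
      rw [Finset.length_toList] at hr'
      exact hr'.trans_le (hR G hG h q)
    have h1 : μ r h q G = some (e, data G e) := by
      simp only [μ]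
      rw [List.getElem?_eq_getElem hr', hre']; rfl
    have h2 : μ r h q G' = some (e, data G e) := (hK' r hrR h q hG hG' hr).symm.trans h1
    simp only [μ, Option.map_eq_some_iff, Prod.mk.injEq] at h2
    obtain ⟨e', h3, rfl, h4⟩ := h2
    have : e' ∈ S h q G' := Finset.mem_toList.1 (List.mem_of_getElem? h3)
    exact ⟨(Finset.mem_filter.1 this).2.2, h4.symm⟩
  refine ⟨K', hre, fun q G hG G' hG' hr => funext fun e => ?_⟩
  simp only [holding]
  by_cases he : pos' G e = some q
  · obtain ⟨h1, h2⟩ := key q G hG G' hG' hr e he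
    rw [if_pos he, if_pos h1, h2]
  · rw [if_neg he, if_neg]
    -- The absence of an item is also known: if it were delivered under `G'`, indistinguishability
    -- would force its delivery under `G`.
    exact fun h1 => he (key q G' hG' G hG ((K' q).symm hr) e h1).1

end Primitives

end CongestedClique

namespace CongestedClique

open Classical

variable {n b : ℕ} {Ω : Type}

/-! ### Global numbering of distributed items -/

section Indexing

variable {ι : Type}

/-- The position of `e ∈ s h` in the concatenation of the finite sets `s 0, s 1, …`. -/
noncomputable def seqIndex (s : Fin n → Finset ι) (h : Fin n) (e : ι) : ℕ :=
  (∑ h' ∈ Finset.univ.filter (· < h), (s h').card) + (s h).toList.idxOf e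

variable {s : Fin n → Finset ι} {h h' : Fin n} {e e' : ι}

theorem seqIndex_lt (he : e ∈ s h) :
    seqIndex s h e < (∑ h' ∈ Finset.univ.filter (· < h), (s h').card) + (s h).card := by
  have : (s h).toList.idxOf e < (s h).toList.length :=
    List.idxOf_lt_length_iff.2 (Finset.mem_toList.2 he)
  rw [Finset.length_toList] at this
  unfold seqIndex; omega

theorem offset_add_card_le_offset (hh : h < h') :
    (∑ i ∈ Finset.univ.filter (· < h), (s i).card) + (s h).card ≤
      ∑ i ∈ Finset.univ.filter (· < h'), (s i).card := by
  rw [add_comm, ← Finset.sum_insert (f := fun i => (s i).card) (by simp)]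
  refine Finset.sum_le_sum_of_subset fun i hi => ?_
  simp only [Finset.mem_insert, Finset.mem_filter, Finset.mem_univ, true_and] at hi ⊢
  rcases hi with rfl | hi
  · exact hh
  · exact hi.trans hh

theorem seqIndex_lt_total (he : e ∈ s h) : seqIndex s h e < ∑ i, (s i).card := by
  refine (seqIndex_lt he).trans_le ?_
  rw [add_comm, ← Finset.sum_insert (f := fun i => (s i).card) (by simp)]
  exact Finset.sum_le_sum_of_subset (Finset.subset_univ _)

theorem seqIndex_inj (he : e ∈ s h) (he' : e' ∈ s h') (heq : seqIndex s h e = seqIndex s h' e') :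
    e = e' := by
  rcases lt_trichotomy h h' with hh | rfl | hh
  · have h1 := seqIndex_lt he
    have h2 := offset_add_card_le_offset (s := s) hh
    have h3 : (∑ i ∈ Finset.univ.filter (· < h'), (s i).card) ≤ seqIndex s h' e' := by
      unfold seqIndex; omega
    omega
  · unfold seqIndex at heq
    exact (List.idxOf_inj (Finset.mem_toList.2 he)).1 (by omega)
  · have h1 := seqIndex_lt he'
    have h2 := offset_add_card_le_offset (s := s) hh
    have h3 : (∑ i ∈ Finset.univ.filter (· < h), (s i).card) ≤ seqIndex s h e := by
      unfold seqIndex; omega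
    omega

/-- An interval of `M * n` indices meets each residue class modulo `n` exactly `M` times. This makes
dealing by index modulo `n` balanced. -/
theorem card_le_of_mod_eq {A : Finset ι} (t : ι → ℕ) (hinj : Set.InjOn t A) {o M n r : ℕ}
    (hA : ∀ e ∈ A, o ≤ t e ∧ t e < o + M * n ∧ t e % n = r) : A.card ≤ M := by
  have : A.card ≤ (Finset.range M).card := by
    refine Finset.card_le_card_of_injOn (fun e => (t e - o) / n) (fun e he => ?_)
      fun e he e' he' hee => hinj he he' ?_
    · obtain ⟨h1, h2, -⟩ := hA e he
      simp only [Finset.coe_range, Set.mem_Iio]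
      refine Nat.div_lt_of_lt_mul ?_
      rw [mul_comm]; omega
    · obtain ⟨h1, h2, h3⟩ := hA e he
      obtain ⟨h4, h5, h6⟩ := hA e' he'
      have hmod : (t e - o) % n = (t e' - o) % n := by
        have : t e ≡ t e' [MOD n] := h3.trans h6.symm
        have h7 : (t e - o) + o ≡ (t e' - o) + o [MOD n] := by
          rwa [Nat.sub_add_cancel h1, Nat.sub_add_cancel h4]
        exact Nat.ModEq.add_right_cancel' o h7
      have hd : (t e - o) / n = (t e' - o) / n := hee
      have : t e - o = t e' - o := by
        rw [← Nat.div_add_mod (t e - o) n, ← Nat.div_add_mod (t e' - o) n, hmod, hd]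
      omega
  simpa using this

theorem card_le_of_interval {A : Finset ι} (t : ι → ℕ) (hinj : Set.InjOn t A) {o k : ℕ}
    (hA : ∀ e ∈ A, o ≤ t e ∧ t e < o + k) : A.card ≤ k := by
  have : A.card ≤ (Finset.Ico o (o + k)).card :=
    Finset.card_le_card_of_injOn t (fun e he => by simpa using hA e he) hinj
  simpa using this

end Indexing

/-! ### Deterministic routing, one binary digit of the destination at a time -/

section Routing

variable {P : Set Ω} {K : Fin n → Setoid Ω} {ι : Type}

theorem knows_holding_unit_iff {s : Setoid Ω} {pos : Ω → ι → Option (Fin n)} {h : Fin n} :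
    Knows P s (holding pos (fun _ _ => ()) h) ↔ Knows P s (fun G => {e | pos G e = some h}) := by
  constructor
  · intro hK
    refine (hK.comp fun f => {e | f e = some ()}).congr fun G _ => ?_
    ext e; simp [holding]
  · intro hK
    refine (hK.comp fun f e => if e ∈ f then some () else none).congr fun G _ => ?_
    funext e; simp [holding]

/-- The state of the routing scheme at level `i`: an item sits at a node that agrees with its
destination modulo `2 ^ i`, and the loads are at most `M * n`. -/
structure IsRoutingState [Fintype ι] (dest : ι → Fin n) (M i : ℕ) (P : Set Ω)
    (pos : Ω → ι → Option (Fin n)) : Prop where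
  load : ∀ G ∈ P, ∀ h, (Finset.univ.filter fun e => pos G e = some h).card ≤ M * n
  recv : ∀ G ∈ P, ∀ u, (Finset.univ.filter fun e => pos G e ≠ none ∧ dest e = u).card ≤ M * n
  mod : ∀ G ∈ P, ∀ e h, pos G e = some h → h.val % 2 ^ i = (dest e).val % 2 ^ i

/-- The items of each class of destinations modulo `2 ^ (i + 1)` are numbered consecutively, and
each block of `M * n` numbers is assigned to one node of the class. Every item travels through the
relay given by its number modulo `n`. A node holds items of only two classes, each with consecutive
numbers, so it sends at most `2 * M` items to a relay; a target receives one block, hence at most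
`M` items from each relay. With two rounds for the counts this makes `3 * M + 2`. -/
theorem exists_reach_routing_level [Fintype ι] {dest : ι → Fin n} {M i : ℕ}
    {pos : Ω → ι → Option (Fin n)} (hb : Fintype.card ι * (n + 1) + 1 ≤ 2 ^ b)
    (hpos : IsRoutingState dest M i P pos)
    (hK : ∀ h, Knows P (K h) (fun G => {e | pos G e = some h})) :
    ∃ K' pos', Reach b P (3 * M + 2) K K' ∧ IsRoutingState dest M (i + 1) P pos' ∧
      (∀ G ∈ P, ∀ e, pos' G e = none ↔ pos G e = none) ∧
      ∀ h, Knows P (K' h) (fun G => {e | pos' G e = some h}) := by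
  let cl : ι → ℕ := fun e => (dest e).val % 2 ^ (i + 1)
  let S : ℕ → Ω → Fin n → Finset ι := fun c G h =>
    Finset.univ.filter fun e => pos G e = some h ∧ cl e = c
  let C : ℕ → Finset (Fin n) := fun c => Finset.univ.filter fun u => u.val % 2 ^ (i + 1) = c
  let t : Ω → ι → ℕ := fun G e => match pos G e with
    | none => 0
    | some h => seqIndex (S (cl e) G) h e
  let relay : Ω → ι → Option (Fin n) := fun G e => match pos G e with
    | none => none
    | some h => some ⟨t G e % n, Nat.mod_lt _ h.pos⟩
  let pos' : Ω → ι → Option (Fin n) := fun G e =>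
    if pos G e = none then none else (C (cl e)).toList[t G e / (M * n)]?
  have ht : ∀ G e h, pos G e = some h → t G e = seqIndex (S (cl e) G) h e := by
    intro G e h he; simp only [t, he]
  have hrelay : ∀ G e h, pos G e = some h → ∃ hlt, relay G e = some ⟨t G e % n, hlt⟩ := by
    intro G e h he
    refine ⟨Nat.mod_lt _ h.pos, ?_⟩
    simp only [relay, he]
  have hmemS : ∀ G e h, pos G e = some h → e ∈ S (cl e) G h := by
    intro G e h he; simp [S, he]
  have hinj : ∀ G e e', pos G e ≠ none → pos G e' ≠ none → cl e = cl e' → t G e = t G e' →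
      e = e' := by
    intro G e e' he he' hc hte
    obtain ⟨h, hh⟩ := Option.ne_none_iff_exists'.1 he
    obtain ⟨h', hh'⟩ := Option.ne_none_iff_exists'.1 he'
    rw [ht G e h hh, ht G e' h' hh', hc] at hte
    exact seqIndex_inj (hc ▸ hmemS G e h hh) (hmemS G e' h' hh') hte
  have htot : ∀ G ∈ P, ∀ e, pos G e ≠ none → t G e < (C (cl e)).card * (M * n) := by
    intro G hG e he
    obtain ⟨h, hh⟩ := Option.ne_none_iff_exists'.1 he
    rw [ht G e h hh]
    refine (seqIndex_lt_total (hmemS G e h hh)).trans_le ?_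
    have h1 : ∑ h', (S (cl e) G h').card =
        (Finset.univ.filter fun e' => pos G e' ≠ none ∧ cl e' = cl e).card := by
      rw [← Finset.card_biUnion]
      · congr 1
        ext e'
        simp only [S, Finset.mem_biUnion, Finset.mem_filter, Finset.mem_univ, true_and,
          Option.ne_none_iff_exists']
        constructor
        · rintro ⟨a, h1, h2⟩; exact ⟨⟨a, h1⟩, h2⟩
        · rintro ⟨⟨a, h1⟩, h2⟩; exact ⟨a, h1, h2⟩
      · intro a _ a' _ haa
        refine Finset.disjoint_left.2 fun e' h1 h2 => haa ?_
        simp only [S, Finset.mem_filter, Finset.mem_univ, true_and] at h1 h2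
        exact Option.some_injective _ (h1.1.symm.trans h2.1)
    rw [h1]
    -- Each node of the class is the destination of at most `M * n` items, so the class has enough
    -- nodes for all blocks.
    refine Finset.card_le_mul_card_image_of_maps_to (f := dest) (t := C (cl e)) ?_ _ ?_ |>.trans
      (le_of_eq (mul_comm _ _))
    · intro e' he'
      simp only [Finset.mem_filter, Finset.mem_univ, true_and, C] at he' ⊢
      exact he'.2
    · intro u _
      refine (Finset.card_le_card fun e' he' => ?_).trans (hpos.recv G hG u)
      simp only [Finset.mem_filter, Finset.mem_univ, true_and] at he' ⊢
      exact ⟨he'.1.1, he'.2⟩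
  have hlen : ∀ G ∈ P, ∀ e, pos G e ≠ none → t G e / (M * n) < (C (cl e)).toList.length := by
    intro G hG e he
    rw [Finset.length_toList]
    exact Nat.div_lt_of_lt_mul (by rw [mul_comm]; exact htot G hG e he)
  have hnone : ∀ G ∈ P, ∀ e, pos' G e = none ↔ pos G e = none := by
    intro G hG e
    by_cases he : pos G e = none
    · simp [pos', he]
    · simp only [pos', if_neg he, he, iff_false]
      rw [List.getElem?_eq_getElem (hlen G hG e he)]
      exact Option.some_ne_none _
  have hpos'mem : ∀ G e q, pos' G e = some q → pos G e ≠ none ∧ q ∈ C (cl e) ∧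
      (C (cl e)).toList[t G e / (M * n)]? = some q := by
    intro G e q he
    by_cases h0 : pos G e = none
    · simp [pos', h0] at he
    · simp only [pos', if_neg h0] at he
      exact ⟨h0, Finset.mem_toList.1 (List.mem_of_getElem? he), he⟩
  -- items with the same new position have indices in a common block
  have hblock : ∀ G ∈ P, ∀ q, ∃ o, ∀ e, pos' G e = some q →
      o ≤ t G e ∧ t G e < o + M * n ∧ cl e = q.val % 2 ^ (i + 1) := by
    intro G hG q
    refine ⟨(C (q.val % 2 ^ (i + 1))).toList.idxOf q * (M * n), fun e he => ?_⟩
    obtain ⟨h0, hq, hget⟩ := hpos'mem G e q he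
    have hc : cl e = q.val % 2 ^ (i + 1) := by
      simp only [C, Finset.mem_filter, Finset.mem_univ, true_and] at hq
      exact hq.symm
    have hl := hlen G hG e h0
    rw [List.getElem?_eq_getElem hl, Option.some.injEq] at hget
    have hidx : (C (q.val % 2 ^ (i + 1))).toList.idxOf q = t G e / (M * n) := by
      rw [← hc]
      conv_lhs => rw [← hget]
      exact (Finset.nodup_toList _).idxOf_getElem _ _
    have hMn : 0 < M * n := by
      rcases Nat.eq_zero_or_pos (M * n) with h | h
      · have := htot G hG e h0; rw [h] at this; simp at this
      · exact h
    refine ⟨?_, ?_, hc⟩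
    · rw [hidx]; exact Nat.div_mul_le_self _ _
    · rw [hidx]; exact Nat.lt_div_mul_add hMn
  have hinj' : ∀ G ∈ P, ∀ q, Set.InjOn (t G) {e | pos' G e = some q} := by
    intro G hG q e he e' he' hee
    obtain ⟨o, ho⟩ := hblock G hG q
    exact hinj G e e' (hpos'mem G e q he).1 (hpos'mem G e' q he').1
      ((ho e he).2.2.trans (ho e' he').2.2.symm) hee
  -- exchange of the counts
  have hcard : Fintype.card ι + 1 ≤ 2 ^ b := by
    refine le_trans ?_ hb
    nlinarith [Nat.zero_le (Fintype.card ι * n)]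
  -- To number its items, `v` needs the counts at all nodes only for the two classes modulo `2 ^ (i
  -- + 1)` that refine its own class modulo `2 ^ i`. Two rounds suffice.
  let μ : ℕ → Fin n → Fin n → Ω → Fin (Fintype.card ι + 1) := fun β u v G =>
    ⟨(S (v.val % 2 ^ i + 2 ^ i * β) G u).card, Nat.lt_succ_of_le (Finset.card_le_univ _)⟩
  obtain ⟨K₁, hr₁, hK₁⟩ := exists_reach_rounds (P := P) (K := K) (b := b) (by simpa using hcard) 2 μ
    (fun β _ u v => ((hK u).comp fun A => (⟨(Finset.univ.filter fun e => e ∈ A ∧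
      cl e = v.val % 2 ^ i + 2 ^ i * β).card, Nat.lt_succ_of_le (Finset.card_le_univ _)⟩ :
        Fin (Fintype.card ι + 1))).congr fun G _ => by simp only [μ, S, Set.mem_ofPred_eq])
  have hcl : ∀ G ∈ P, ∀ e h, pos G e = some h →
      ∃ β < 2, cl e = h.val % 2 ^ i + 2 ^ i * β := by
    intro G hG e h he
    refine ⟨(dest e).val / 2 ^ i % 2, Nat.mod_lt _ two_pos, ?_⟩
    rw [hpos.mod G hG e h he]
    exact Nat.mod_pow_succ
  have hhold : ∀ h, Knows P (K₁ h) (holding pos (fun G e => (pos' G e, relay G e)) h) := by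
    intro h G hG G' hG' hr
    have hset : {e | pos G e = some h} = {e | pos G' e = some h} := hr₁.knows (hK h) hG hG' hr
    have hiff : ∀ e, pos G e = some h ↔ pos G' e = some h := fun e => Set.ext_iff.1 hset e
    funext e
    by_cases he : pos G e = some h
    · have he' := (hiff e).1 he
      have hte : t G e = t G' e := by
        rw [ht G e h he, ht G' e h he']
        obtain ⟨β, hβ, hc⟩ := hcl G hG e h he
        have hcnt : ∀ u, (S (cl e) G u).card = (S (cl e) G' u).card := by
          intro u
          have := hK₁ β hβ u h hG hG' hr
          simp only [μ, Fin.mk.injEq] at this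
          rw [hc]; exact this
        have hSh : S (cl e) G h = S (cl e) G' h := by
          ext e'
          simp only [S, Finset.mem_filter, Finset.mem_univ, true_and, hiff]
        unfold seqIndex
        rw [hSh]
        simp only [hcnt]
      obtain ⟨hl, h1⟩ := hrelay G e h he
      obtain ⟨hl', h1'⟩ := hrelay G' e h he'
      simp only [holding, h1, h1', pos', he, he', hte]
    · simp only [holding, if_neg he, if_neg fun h' => he ((hiff e).2 h')]
  obtain ⟨K₂, hr₂, hK₂⟩ := exists_reach_deliver (P := P) (K := K₁) (b := b)
    (δ := Option (Fin n)) (by simpa using hb) (2 * M) pos relay pos'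
    (fun G _ e he => by simp only [relay, he]) hhold (by
      intro G hG h q
      have hsub : (Finset.univ.filter fun e => pos G e = some h ∧ relay G e = some q) ⊆
          (Finset.range 2).biUnion fun β => Finset.univ.filter fun e =>
            e ∈ S (h.val % 2 ^ i + 2 ^ i * β) G h ∧ t G e % n = q.val := by
        intro e he
        simp only [Finset.mem_filter, Finset.mem_univ, true_and] at he
        obtain ⟨β, hβ, hc⟩ := hcl G hG e h he.1
        obtain ⟨hl, h1⟩ := hrelay G e h he.1
        rw [h1, Option.some.injEq] at he
        simp only [Finset.mem_biUnion, Finset.mem_range, Finset.mem_filter, Finset.mem_univ,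
          true_and]
        exact ⟨β, hβ, hc ▸ hmemS G e h he.1, congrArg Fin.val he.2⟩
      refine (Finset.card_le_card hsub).trans (Finset.card_biUnion_le_card_mul _ _ M ?_)
      intro β _
      set c := h.val % 2 ^ i + 2 ^ i * β
      have hS : ∀ e ∈ S c G h, pos G e = some h ∧ cl e = c := fun e he => by
        simpa [S] using he
      refine card_le_of_mod_eq (t G) (o := ∑ h' ∈ Finset.univ.filter (· < h), (S c G h').card)
        (n := n) (r := q.val) ?_ ?_
      · intro e he e' he' hee
        simp only [Finset.coe_filter, Finset.mem_univ, true_and, Set.mem_ofPred_eq] at he he'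
        have h1 := hS e he.1
        have h2 := hS e' he'.1
        exact hinj G e e' (by rw [h1.1]; simp) (by rw [h2.1]; simp) (h1.2.trans h2.2.symm) hee
      · intro e he
        simp only [Finset.mem_filter, Finset.mem_univ, true_and] at he
        have h1 := hS e he.1
        have h2 := seqIndex_lt he.1
        have h3 : (S c G h).card ≤ M * n :=
          (Finset.card_le_card fun e' he' => by simpa using (hS e' he').1).trans (hpos.load G hG h)
        refine ⟨?_, ?_, he.2⟩
        · rw [ht G e h h1.1, h1.2]; unfold seqIndex; omega
        · rw [ht G e h h1.1, h1.2]; omega)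
  have hb' : Fintype.card ι * Fintype.card Unit + 1 ≤ 2 ^ b := by simpa using hcard
  have hrelay_none : ∀ G e, relay G e = none ↔ pos G e = none := by
    intro G e
    rcases hx : pos G e with _ | h
    · simp [relay, hx]
    · obtain ⟨_, h1⟩ := hrelay G e h hx
      rw [h1]; simp
  obtain ⟨K₃, hr₃, hK₃⟩ := exists_reach_deliver (P := P) (K := K₂) (b := b) (δ := Unit) hb' M
    relay pos' (fun _ _ => ())
    (fun G hG e he => (hnone G hG e).2 ((hrelay_none G e).1 he))
    (fun h => ((hK₂ h).comp fun f e => (f e).map fun x => ((), x)).congr fun G hG => by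
      funext e
      by_cases he : relay G e = some h <;> simp [holding, he]) (by
      intro G hG h q
      obtain ⟨o, ho⟩ := hblock G hG q
      refine card_le_of_mod_eq (t G) (o := o) (n := n) (r := h.val) ?_ ?_
      · refine (hinj' G hG q).mono fun e he => ?_
        simp only [Finset.coe_filter, Finset.mem_univ, true_and, Set.mem_ofPred_eq] at he
        exact he.2
      · intro e he
        simp only [Finset.mem_filter, Finset.mem_univ, true_and] at he
        obtain ⟨h1, h2, -⟩ := ho e he.2
        refine ⟨h1, h2, ?_⟩
        obtain ⟨a, ha⟩ := Option.ne_none_iff_exists'.1 (hpos'mem G e q he.2).1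
        obtain ⟨hl, h3⟩ := hrelay G e a ha
        rw [h3, Option.some.injEq] at he
        exact congrArg Fin.val he.1)
  refine ⟨K₃, pos', ((hr₁.trans hr₂).trans hr₃).mono (by omega), ⟨?_, ?_, ?_⟩, hnone,
    fun h => knows_holding_unit_iff.1 (hK₃ h)⟩
  · intro G hG q
    obtain ⟨o, ho⟩ := hblock G hG q
    refine card_le_of_interval (t G) (o := o) ?_ ?_
    · refine (hinj' G hG q).mono fun e he => ?_
      simpa using he
    · intro e he
      simp only [Finset.mem_filter, Finset.mem_univ, true_and] at he
      exact ⟨(ho e he).1, (ho e he).2.1⟩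
  · intro G hG u
    refine le_trans (Finset.card_le_card fun e he => ?_) (hpos.recv G hG u)
    simp only [Finset.mem_filter, Finset.mem_univ, true_and, ne_eq, hnone G hG] at he ⊢
    exact he
  · intro G hG e q he
    obtain ⟨o, ho⟩ := hblock G hG q
    exact (ho e he).2.2.symm

/-- Deterministic routing: if every node holds at most `M * n` items and is the destination of at
most `M * n` items, then all items can be delivered in `O(M log n)` rounds. -/
theorem exists_reach_route [Fintype ι] {dest : ι → Fin n} {M : ℕ}
    {pos : Ω → ι → Option (Fin n)} (hb : Fintype.card ι * (n + 1) + 1 ≤ 2 ^ b)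
    (hload : ∀ G ∈ P, ∀ h, (Finset.univ.filter fun e => pos G e = some h).card ≤ M * n)
    (hrecv : ∀ G ∈ P, ∀ u,
      (Finset.univ.filter fun e => pos G e ≠ none ∧ dest e = u).card ≤ M * n)
    (hK : ∀ h, Knows P (K h) (fun G => {e | pos G e = some h})) :
    ∃ K', Reach b P (Nat.clog 2 n * (3 * M + 2)) K K' ∧
      ∀ u, Knows P (K' u) (fun G => {e | pos G e ≠ none ∧ dest e = u}) := by
  have key : ∀ i, ∃ K' pos', Reach b P (i * (3 * M + 2)) K K' ∧ IsRoutingState dest M i P pos' ∧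
      (∀ G ∈ P, ∀ e, pos' G e = none ↔ pos G e = none) ∧
      ∀ h, Knows P (K' h) (fun G => {e | pos' G e = some h}) := by
    intro i
    induction i with
    | zero =>
      exact ⟨K, pos, Reach.refl.mono (Nat.zero_le _), ⟨hload, hrecv, fun _ _ _ _ _ => by
        simp [Nat.mod_one]⟩, fun _ _ _ => Iff.rfl, hK⟩
    | succ i ih =>
      obtain ⟨K₁, pos₁, h1, h2, h3, h4⟩ := ih
      obtain ⟨K₂, pos₂, h5, h6, h7, h8⟩ := exists_reach_routing_level hb h2 h4
      exact ⟨K₂, pos₂, (h1.trans h5).mono (le_of_eq (by ring)), h6,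
        fun G hG e => (h7 G hG e).trans (h3 G hG e), h8⟩
  obtain ⟨K', pos', h1, h2, h3, h4⟩ := key (Nat.clog 2 n)
  refine ⟨K', h1, fun u => (h4 u).congr fun G hG => ?_⟩
  -- After `Nat.clog 2 n` levels the modulus is at least `n`, so congruence with the destination is
  -- equality.
  have hlt : ∀ v : Fin n, v.val < 2 ^ Nat.clog 2 n := fun v =>
    v.isLt.trans_le (Nat.le_pow_clog one_lt_two n)
  have hd : ∀ e h, pos' G e = some h → h = dest e := fun e h he => by
    have := h2.mod G hG e h he
    rw [Nat.mod_eq_of_lt (hlt _), Nat.mod_eq_of_lt (hlt _)] at this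
    exact Fin.ext this
  ext e
  simp only [Set.mem_ofPred_eq, ne_eq, ← h3 G hG]
  constructor
  · intro he
    exact ⟨by rw [he]; simp, (hd e u he).symm⟩
  · rintro ⟨he, rfl⟩
    obtain ⟨h, hh⟩ := Option.ne_none_iff_exists'.1 he
    rw [hh, hd e h hh]

end Routing

end CongestedClique

/-! ### A weak Moore bound -/

namespace SimpleGraph

open Classical

variable {V : Type} {G : SimpleGraph V}

/-- The union of two distinct paths with common ends is not a forest, and a cycle in it uses each
edge of the union at most once. -/
theorem egirth_le_length_add_length {u v : V} {p q : G.Walk u v} (hp : p.IsPath) (hq : q.IsPath)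
    (hpq : p ≠ q) : G.egirth ≤ (p.length + q.length : ℕ) := by
  let H : SimpleGraph V := fromEdgeSet {e | e ∈ p.edges ++ q.edges}
  have hpH : ∀ e ∈ p.edges, e ∈ H.edgeSet := fun e he => by
    rw [edgeSet_fromEdgeSet]
    exact ⟨List.mem_append_left _ he, G.not_isDiag_of_mem_edgeSet (p.edges_subset_edgeSet he)⟩
  have hqH : ∀ e ∈ q.edges, e ∈ H.edgeSet := fun e he => by
    rw [edgeSet_fromEdgeSet]
    exact ⟨List.mem_append_right _ he, G.not_isDiag_of_mem_edgeSet (q.edges_subset_edgeSet he)⟩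
  have hHG : H ≤ G := by
    rw [← edgeSet_subset_edgeSet, edgeSet_fromEdgeSet]
    rintro e ⟨he, -⟩
    rcases List.mem_append.1 he with he | he
    · exact p.edges_subset_edgeSet he
    · exact q.edges_subset_edgeSet he
  have hH : ¬ H.IsAcyclic := by
    intro hac
    have := (hac.subsingleton_path u v).elim ⟨p.transfer H hpH, hp.transfer hpH⟩ ⟨q.transfer H hqH, hq.transfer hqH⟩
    have h2 : p.transfer H hpH = q.transfer H hqH := congrArg Subtype.val this
    apply hpq
    have h3 : (p.transfer H hpH).transfer G (fun e he => by
        rw [Walk.edges_transfer] at he; exact p.edges_subset_edgeSet he) =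
        (q.transfer H hqH).transfer G (fun e he => by
        rw [Walk.edges_transfer] at he; exact q.edges_subset_edgeSet he) := by
      simp only [h2]
    rwa [Walk.transfer_transfer, Walk.transfer_transfer, Walk.transfer_self,
      Walk.transfer_self] at h3
  simp only [IsAcyclic, not_forall, not_not] at hH
  obtain ⟨w, c, hc⟩ := hH
  refine (egirth_anti hHG).trans ((egirth_le_length hc).trans ?_)
  have hsub : c.edges ⊆ p.edges ++ q.edges := fun e he => by
    have := c.edges_subset_edgeSet he
    rw [edgeSet_fromEdgeSet] at this
    exact this.1
  have := (hc.edges_nodup.subperm hsub).length_le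
  rw [List.length_append, Walk.length_edges, Walk.length_edges, Walk.length_edges] at this
  exact_mod_cast this

theorem exists_isPath_concat {v x y : V} {a : ℕ} (hx : G.edist v x = a) (hxy : G.Adj x y)
    (hy : (a : ℕ∞) ≤ G.edist v y) :
    ∃ p : G.Walk v y, p.IsPath ∧ p.length = a + 1 ∧ p.penultimate = x := by
  obtain ⟨p, hp⟩ := exists_walk_of_edist_eq_coe hx
  have hpp : p.IsPath := by
    refine p.isPath_of_length_eq_dist ?_
    rw [hp, dist, hx]; rfl
  have hyp : y ∉ p.support := by
    intro hmem
    have h1 : (a : ℕ∞) ≤ (p.takeUntil y hmem).length := hy.trans (edist_le _)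
    have h2 : (p.takeUntil y hmem).length + (p.dropUntil y hmem).length = p.length := by
      rw [← Walk.length_append, p.take_spec]
    have h3 : a ≤ (p.takeUntil y hmem).length := by exact_mod_cast h1
    exact hxy.ne (Walk.eq_of_length_eq_zero (p := p.dropUntil y hmem) (by omega)).symm
  exact ⟨p.concat hxy, hpp.concat hyp hxy, by rw [Walk.length_concat, hp],
    Walk.penultimate_concat _ _⟩

/-- Two such neighbours would give two different paths from `v` to `y`, each of length at most `k`,
against the girth. So a node within distance `k` has at most one neighbour that precedes it in the
search from `v`, and no two nodes of a layer below `k` are adjacent. -/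
theorem eq_of_adj_of_edist_lt {k : ℕ} (hG : (2 * k : ℕ) < G.egirth) {v x x' y : V}
    (hx : G.edist v x < k) (hx' : G.edist v x' < k) (hxy : G.Adj x y) (hxy' : G.Adj x' y)
    (hle : G.edist v x ≤ G.edist v y) (hle' : G.edist v x' ≤ G.edist v y) : x = x' := by
  obtain ⟨a, ha⟩ := ENat.ne_top_iff_exists.1 hx.ne_top
  obtain ⟨a', ha'⟩ := ENat.ne_top_iff_exists.1 hx'.ne_top
  rw [← ha] at hx hle
  rw [← ha'] at hx' hle'
  obtain ⟨p, hp, hpl, hpx⟩ := exists_isPath_concat ha.symm hxy hle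
  obtain ⟨q, hq, hql, hqx⟩ := exists_isPath_concat ha'.symm hxy' hle'
  by_contra hne
  have hpq : p ≠ q := fun h => hne (by rw [← hpx, ← hqx, h])
  have h1 := hG.trans_le (egirth_le_length_add_length hp hq hpq)
  have h2 : 2 * k < p.length + q.length := by exact_mod_cast h1
  have h3 : a < k := by exact_mod_cast hx
  have h4 : a' < k := by exact_mod_cast hx'
  omega

variable [Fintype V]

/-- A node of sphere `i` has at most one neighbour not on sphere `i + 1`, so at least `D` neighbours
on it; a node of sphere `i + 1` has only one neighbour on sphere `i`. Double counting multiplies the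
size by `D`. -/
theorem pow_le_card_sphere {k D : ℕ} (hG : (2 * k : ℕ) < G.egirth) (v : V)
    (hdeg : ∀ x, G.Reachable v x → D + 1 ≤ (Finset.univ.filter (G.Adj x)).card) {i : ℕ}
    (hi : i ≤ k) : D ^ i ≤ (Finset.univ.filter fun x => G.edist v x = i).card := by
  induction i with
  | zero =>
    rw [pow_zero, Nat.one_le_iff_ne_zero, Finset.card_ne_zero]
    exact ⟨v, by simp⟩
  | succ i ih =>
    have hik : (i : ℕ∞) < k := by exact_mod_cast hi
    have key := Finset.card_mul_le_card_mul (s := Finset.univ.filter fun x => G.edist v x = i)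
      (t := Finset.univ.filter fun x => G.edist v x = (i + 1 : ℕ)) G.Adj (m := D) (n := 1) ?_ ?_
    · rw [pow_succ, ← mul_one (Finset.card (Finset.univ.filter
        fun x => G.edist v x = (i + 1 : ℕ)))]
      exact (Nat.mul_le_mul_right D (ih (by omega))).trans key
    · intro x hx
      simp only [Finset.mem_filter, Finset.mem_univ, true_and] at hx
      have hreach : G.Reachable v x := reachable_of_edist_ne_top (by rw [hx]; simp)
      have h1 := hdeg x hreach
      have hsplit : Finset.univ.filter (G.Adj x) ⊆ Finset.bipartiteAbove G.Adj
          (Finset.univ.filter fun y => G.edist v y = (i + 1 : ℕ)) x ∪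
          Finset.univ.filter fun y => G.Adj x y ∧ G.edist v y ≤ i := by
        intro y hy
        simp only [Finset.mem_filter, Finset.mem_univ, true_and] at hy
        have htri : G.edist v y ≤ (i + 1 : ℕ) := by
          refine (G.edist_triangle (v := x)).trans ?_
          rw [hx, edist_eq_one_iff_adj.2 hy]; simp
        simp only [Finset.mem_union, Finset.mem_bipartiteAbove, Finset.mem_filter,
          Finset.mem_univ, true_and]
        rcases htri.lt_or_eq with h | h
        · right
          refine ⟨hy, ?_⟩
          obtain ⟨c, hc⟩ := ENat.ne_top_iff_exists.1 h.ne_top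
          rw [← hc] at h ⊢
          have : c < i + 1 := by exact_mod_cast h
          exact_mod_cast Nat.lt_succ_iff.1 this
        · exact Or.inl ⟨h, hy⟩
      have h2 : (Finset.univ.filter fun y => G.Adj x y ∧ G.edist v y ≤ i).card ≤ 1 := by
        refine Finset.card_le_one.2 fun y hy y' hy' => ?_
        simp only [Finset.mem_filter, Finset.mem_univ, true_and] at hy hy'
        exact eq_of_adj_of_edist_lt hG (hy.2.trans_lt hik) (hy'.2.trans_lt hik) hy.1.symm
          hy'.1.symm (hx ▸ hy.2) (hx ▸ hy'.2)
      have h3 := (Finset.card_le_card hsplit).trans (Finset.card_union_le _ _)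
      omega
    · intro y hy
      simp only [Finset.mem_filter, Finset.mem_univ, true_and] at hy
      refine Finset.card_le_one.2 fun x hx x' hx' => ?_
      simp only [Finset.mem_bipartiteBelow, Finset.mem_filter, Finset.mem_univ, true_and] at hx hx'
      have hle : (i : ℕ∞) ≤ G.edist v y := by rw [hy]; exact_mod_cast Nat.le_succ i
      exact eq_of_adj_of_edist_lt hG (hx.1 ▸ hik) (hx'.1 ▸ hik) hx.2 hx'.2 (hx.1 ▸ hle)
        (hx'.1 ▸ hle)

/-- The number of ordered pairs of adjacent vertices, that is, twice the number of edges. -/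
noncomputable def arcCount (G : SimpleGraph V) : ℕ :=
  (Finset.univ.filter fun p : V × V => G.Adj p.1 p.2).card

/-- In a smallest set spanning more than `2 * D` arcs per node, a node of degree at most `D` could
be deleted: it takes away at most `2 * D` arcs. -/
theorem exists_minDegree_of_lt_arcCount {D : ℕ} (h : 2 * D * Fintype.card V < G.arcCount) :
    ∃ T : Finset V, T.Nonempty ∧
      ∀ x ∈ T, D + 1 ≤ (Finset.univ.filter fun y => G.Adj x y ∧ y ∈ T).card := by
  let E : Finset V → Finset (V × V) := fun T =>
    Finset.univ.filter fun p => G.Adj p.1 p.2 ∧ p.1 ∈ T ∧ p.2 ∈ T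
  have hex : ∃ c, ∃ T : Finset V, T.card = c ∧ 2 * D * T.card < (E T).card :=
    ⟨_, Finset.univ, rfl, by simpa [E, arcCount] using h⟩
  obtain ⟨T, hT, hE⟩ := Nat.find_spec hex
  refine ⟨T, ?_, fun x hx => ?_⟩
  · rw [Finset.nonempty_iff_ne_empty]
    rintro rfl
    simp [E] at hE
  · by_contra hlt
    push Not at hlt
    have hmin := Nat.find_min hex (m := (T.erase x).card) (by
      rw [← hT]; exact Finset.card_erase_lt_of_mem hx)
    refine hmin ⟨T.erase x, rfl, ?_⟩
    set N := Finset.univ.filter fun y => G.Adj x y ∧ y ∈ T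
    have hsub : E T ⊆ E (T.erase x) ∪ (N.image (fun y => (x, y)) ∪ N.image fun y => (y, x)) := by
      rintro ⟨a, c⟩ hac
      simp only [E, N, Finset.mem_union, Finset.mem_filter, Finset.mem_univ, true_and,
        Finset.mem_erase, Finset.mem_image, Prod.mk.injEq] at hac ⊢
      obtain ⟨h1, h2, h3⟩ := hac
      by_cases ha : a = x
      · subst ha; exact Or.inr (Or.inl ⟨c, ⟨h1, h3⟩, rfl, rfl⟩)
      · by_cases hc : c = x
        · subst hc; exact Or.inr (Or.inr ⟨a, ⟨h1.symm, h2⟩, rfl, rfl⟩)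
        · exact Or.inl ⟨h1, ⟨ha, h2⟩, hc, h3⟩
    have h1 := (Finset.card_le_card hsub).trans ((Finset.card_union_le _ _).trans
      (Nat.add_le_add_left (Finset.card_union_le _ _) _))
    have h2 := Finset.card_image_le (s := N) (f := fun y => (x, y))
    have h3 := Finset.card_image_le (s := N) (f := fun y => (y, x))
    have h4 := Finset.card_erase_add_one hx
    have h5 : 2 * D * T.card = 2 * D * (T.erase x).card + 2 * D := by rw [← h4]; ring
    omega

theorem pow_le_card_of_lt_arcCount {k D : ℕ} (hG : (2 * k : ℕ) < G.egirth)
    (h : 2 * D * Fintype.card V < G.arcCount) : D ^ k ≤ Fintype.card V := by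
  obtain ⟨T, ⟨v, hv⟩, hdeg⟩ := exists_minDegree_of_lt_arcCount h
  let H : SimpleGraph V :=
    { Adj := fun x y => G.Adj x y ∧ x ∈ T ∧ y ∈ T
      symm := ⟨fun x y h => ⟨h.1.symm, h.2.2, h.2.1⟩⟩
      loopless := ⟨fun x h => G.loopless.irrefl x h.1⟩ }
  have hHG : H ≤ G := fun x y h => h.1
  have hreach : ∀ x, H.Reachable v x → x ∈ T := by
    rintro x ⟨p⟩
    induction p with
    | nil => exact hv
    | cons h p ih => exact ih h.2.2
  refine (pow_le_card_sphere (hG.trans_le (egirth_anti hHG)) v (D := D) (fun x hx => ?_)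
    le_rfl).trans (Finset.card_le_univ _)
  refine (hdeg x (hreach x hx)).trans (Finset.card_le_card fun y hy => ?_)
  simp only [Finset.mem_filter, Finset.mem_univ, true_and] at hy ⊢
  exact ⟨hy.1, hreach x hx, hy.2⟩

/-- A weak form of the Moore bound. -/
theorem arcCount_le_of_lt_egirth {k : ℕ} (hk : k ≠ 0) (hG : (2 * k : ℕ) < G.egirth) :
    (G.arcCount : ℝ) ≤
      2 * Fintype.card V * ((Fintype.card V : ℝ) ^ (1 / (k : ℝ)) + 1) := by
  set x : ℝ := (Fintype.card V : ℝ) ^ (1 / (k : ℝ))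
  have hx : 0 ≤ x := Real.rpow_nonneg (Nat.cast_nonneg _) _
  have hxk : x ^ k = Fintype.card V := by
    rw [← Real.rpow_natCast, ← Real.rpow_mul (Nat.cast_nonneg _), one_div,
      inv_mul_cancel₀ (by exact_mod_cast hk), Real.rpow_one]
  by_contra! hlt
  -- The degree `⌊x⌋₊ + 1` is the least integer above `x`, so its `k`-th power exceeds the number of
  -- vertices.
  have h1 : 2 * (⌊x⌋₊ + 1) * Fintype.card V < G.arcCount := by
    have h2 : (⌊x⌋₊ : ℝ) ≤ x := Nat.floor_le hx
    have : ((2 * (⌊x⌋₊ + 1) * Fintype.card V : ℕ) : ℝ) < G.arcCount := by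
      push_cast
      refine lt_of_le_of_lt ?_ hlt
      have : (0 : ℝ) ≤ Fintype.card V := Nat.cast_nonneg _
      nlinarith
    exact_mod_cast this
  have h3 := pow_le_card_of_lt_arcCount hG h1
  have h4 : x ^ k < ((⌊x⌋₊ + 1 : ℕ) : ℝ) ^ k :=
    pow_lt_pow_left₀ (by push_cast; exact Nat.lt_floor_add_one x) hx hk
  rw [hxk] at h4
  have h5 : (((⌊x⌋₊ + 1) ^ k : ℕ) : ℝ) ≤ Fintype.card V := by exact_mod_cast h3
  push_cast at h4 h5
  linarith

end SimpleGraph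

namespace CongestedClique

open Classical

variable {n : ℕ}

/-! ### Balanced intervals -/

section Cells

/-- The part of `v` when `0, …, n - 1` is cut into `p` intervals of about the same weight. -/
noncomputable def cell (p : ℕ) (w : Fin n → ℝ) (v : Fin n) : ℕ :=
  min (p - 1) ⌊p * (∑ x ∈ Finset.univ.filter (· < v), w x) / ∑ x, w x⌋₊

variable {p : ℕ} {w : Fin n → ℝ}

theorem cell_lt (hp : 0 < p) (v : Fin n) : cell p w v < p :=
  (min_le_left _ _).trans_lt (by omega)

theorem cell_mono (hw : ∀ v, 0 ≤ w v) {u v : Fin n} (huv : u ≤ v) : cell p w u ≤ cell p w v := by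
  refine min_le_min le_rfl (Nat.floor_le_floor ?_)
  refine div_le_div_of_nonneg_right (mul_le_mul_of_nonneg_left ?_ (Nat.cast_nonneg _))
    (Finset.sum_nonneg fun x _ => hw x)
  refine Finset.sum_le_sum_of_subset_of_nonneg (fun x hx => ?_) fun x _ _ => hw x
  simp only [Finset.mem_filter, Finset.mem_univ, true_and] at hx ⊢
  exact hx.trans_le huv

/-- The last node of a cell may be arbitrarily heavy. Without it, the cell weighs at most the
difference of two prefix sums in the same slot of width `(∑ v, w v) / p`. -/
theorem exists_sum_erase_cell_le (hw : ∀ v, 0 ≤ w v) (hp : 0 < p) {c : ℕ}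
    (hc : (Finset.univ.filter fun v => cell p w v = c).Nonempty) :
    ∃ z, ∑ v ∈ (Finset.univ.filter fun v => cell p w v = c).erase z, w v ≤ (∑ v, w v) / p := by
  set s := Finset.univ.filter fun v => cell p w v = c
  have hp' : (0 : ℝ) < p := by exact_mod_cast hp
  have hW : 0 ≤ ∑ v, w v := Finset.sum_nonneg fun x _ => hw x
  refine ⟨s.max' hc, ?_⟩
  set z := s.max' hc
  set y := s.min' hc
  have hz : cell p w z = c := (Finset.mem_filter.1 (s.max'_mem hc)).2
  have hy : cell p w y = c := (Finset.mem_filter.1 (s.min'_mem hc)).2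
  rcases hW.eq_or_lt with h0 | hpos
  · refine (Finset.sum_le_sum_of_subset_of_nonneg (Finset.subset_univ _)
      fun x _ _ => hw x).trans ?_
    rw [← h0]; simp
  set S : Fin n → ℝ := fun v => ∑ x ∈ Finset.univ.filter (· < v), w x
  have hyz : y ≤ z := s.min'_le z (s.max'_mem hc)
  have h1 : ∑ v ∈ s.erase z, w v ≤ S z - S y := by
    have hsub : s.erase z ∪ Finset.univ.filter (· < y) ⊆ Finset.univ.filter (· < z) := by
      intro x hx
      simp only [Finset.mem_union, Finset.mem_erase, Finset.mem_filter, Finset.mem_univ,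
        true_and] at hx ⊢
      rcases hx with ⟨h1, h2⟩ | h
      · exact lt_of_le_of_ne (s.le_max' x h2) h1
      · exact h.trans_le hyz
    have hdisj : Disjoint (s.erase z) (Finset.univ.filter (· < y)) := by
      refine Finset.disjoint_left.2 fun x hx hx' => ?_
      simp only [Finset.mem_filter, Finset.mem_univ, true_and] at hx'
      exact absurd (s.min'_le x (Finset.mem_of_mem_erase hx)) (not_le.2 hx')
    have := Finset.sum_le_sum_of_subset_of_nonneg hsub fun x _ _ => hw x
    rw [Finset.sum_union hdisj] at this
    linarith
  have h2 : (c : ℝ) ≤ p * S y / ∑ x, w x := by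
    have : c ≤ ⌊p * S y / ∑ x, w x⌋₊ := hy ▸ min_le_right _ _
    refine (Nat.cast_le.2 this).trans (Nat.floor_le ?_)
    exact div_nonneg (mul_nonneg hp'.le (Finset.sum_nonneg fun x _ => hw x)) hW
  have h3 : p * S z / ∑ x, w x ≤ c + 1 := by
    -- If the cap `p - 1` is attained, the upper end of the slot is the total weight.
    rcases min_choice (p - 1) ⌊p * S z / ∑ x, w x⌋₊ with h | h
    · have hcp : c = p - 1 := hz.symm.trans h
      have : (c : ℝ) + 1 = p := by
        have : c + 1 = p := by omega
        exact_mod_cast this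
      rw [this, div_le_iff₀ hpos]
      refine mul_le_mul_of_nonneg_left ?_ hp'.le
      exact Finset.sum_le_sum_of_subset_of_nonneg (Finset.subset_univ _) fun x _ _ => hw x
    · have : c = ⌊p * S z / ∑ x, w x⌋₊ := hz.symm.trans h
      rw [this]
      exact (Nat.lt_floor_add_one _).le
  rw [le_div_iff₀ hpos] at h2
  rw [div_le_iff₀ hpos] at h3
  rw [le_div_iff₀ hp']
  nlinarith

/-- When `w` dominates the normalised `f`, balance for `w` gives balance for `f`. The exceptional
heavy node costs at most `n`, which is the additive term. -/
theorem sum_cell_le (hw : ∀ v, 0 ≤ w v) (hp : 0 < p) {f : Fin n → ℕ} (hf : ∀ v, f v ≤ n)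
    (hfw : ∀ v, (f v : ℝ) / (∑ x, f x : ℕ) ≤ w v) {k : ℝ} (hk : ∑ v, w v ≤ k) (c : ℕ) :
    ((∑ v ∈ Finset.univ.filter fun v => cell p w v = c, f v : ℕ) : ℝ) ≤
      (∑ x, f x : ℕ) * k / p + n := by
  have hp' : (0 : ℝ) < p := by exact_mod_cast hp
  have hk0 : 0 ≤ k := (Finset.sum_nonneg fun x _ => hw x).trans hk
  rcases Finset.eq_empty_or_nonempty (Finset.univ.filter fun v => cell p w v = c) with h0 | hc
  · rw [h0]; simp only [Finset.sum_empty, Nat.cast_zero]; positivity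
  obtain ⟨z, hz⟩ := exists_sum_erase_cell_le hw hp hc
  set s := Finset.univ.filter fun v => cell p w v = c
  have h1 : ∑ v ∈ s, f v ≤ ∑ v ∈ s.erase z, f v + n := by
    by_cases hzs : z ∈ s
    · rw [← Finset.sum_erase_add _ _ hzs]
      exact Nat.add_le_add_left (hf z) _
    · rw [Finset.erase_eq_of_notMem hzs]; exact Nat.le_add_right _ _
  have h2 : ((∑ v ∈ s.erase z, f v : ℕ) : ℝ) ≤ (∑ x, f x : ℕ) * k / p := by
    rcases Nat.eq_zero_or_pos (∑ x, f x) with h0 | hpos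
    · have : ∑ v ∈ s.erase z, f v = 0 := Nat.le_zero.1
        (h0 ▸ Finset.sum_le_sum_of_subset (Finset.subset_univ _))
      rw [this, h0]; simp
    · have hF : (0 : ℝ) < (∑ x, f x : ℕ) := by exact_mod_cast hpos
      have h3 : (∑ v ∈ s.erase z, (f v : ℝ)) / (∑ x, f x : ℕ) ≤ k / p := by
        rw [Finset.sum_div]
        refine (Finset.sum_le_sum fun v _ => hfw v).trans (hz.trans ?_)
        exact div_le_div_of_nonneg_right hk hp'.le
      rw [div_le_iff₀ hF] at h3
      calc ((∑ v ∈ s.erase z, f v : ℕ) : ℝ) = ∑ v ∈ s.erase z, (f v : ℝ) := by push_cast; rfl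
        _ ≤ k / p * (∑ x, f x : ℕ) := h3
        _ = (∑ x, f x : ℕ) * k / p := by ring
  have h4 : ((∑ v ∈ s, f v : ℕ) : ℝ) ≤ (∑ v ∈ s.erase z, f v : ℕ) + n := by exact_mod_cast h1
  linarith

end Cells

/-! ### The tree of partitions -/

section Parts

variable (p : ℕ) (G : SimpleGraph (Fin n)) (a : ℕ → ℕ)

/-- The number of neighbours of `v` in `I`. -/
noncomputable def degInto (v : Fin n) (I : Finset (Fin n)) : ℕ :=
  (Finset.univ.filter fun y => G.Adj v y ∧ y ∈ I).card

/-- The number of arcs that end in `I`. -/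
noncomputable def degSum (I : Finset (Fin n)) : ℕ := ∑ v ∈ I, degInto G v Finset.univ

/-- The tree of partitions: given the first `j` parts on the branch `a`, the nodes are cut into `p`
intervals that are balanced with respect to the degree and to the number of neighbours in each of
these parts; `a j` selects one interval. -/
noncomputable def part (j : ℕ) : Finset (Fin n) :=
  Finset.univ.filter fun v => cell p (fun v =>
    (degInto G v Finset.univ : ℝ) / degSum G Finset.univ +
      ∑ i : Fin j, (degInto G v (part i) : ℝ) / degSum G (part i)) v = a j
termination_by j
decreasing_by all_goals exact i.isLt

/-- The weights that are balanced at level `j` of the tree of partitions. -/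
noncomputable def partWeight (j : ℕ) (v : Fin n) : ℝ :=
  (degInto G v Finset.univ : ℝ) / degSum G Finset.univ +
    ∑ i : Fin j, (degInto G v (part p G a i) : ℝ) / degSum G (part p G a i)

variable {p G a}

theorem part_eq (j : ℕ) :
    part p G a j = Finset.univ.filter fun v => cell p (partWeight p G a j) v = a j := by
  rw [part]; rfl

theorem part_congr {a' : ℕ → ℕ} {j : ℕ} (h : ∀ i ≤ j, a i = a' i) :
    part p G a j = part p G a' j := by
  induction j using Nat.strong_induction_on with
  | _ j ih =>
    have : partWeight p G a j = partWeight p G a' j := by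
      funext v
      unfold partWeight
      congr 1
      refine Finset.sum_congr rfl fun i _ => ?_
      rw [ih i i.2 fun k hk => h k (hk.trans i.2.le)]
    rw [part_eq, part_eq, this, h j le_rfl]

theorem partWeight_congr {a' : ℕ → ℕ} {j : ℕ} (h : ∀ i < j, a i = a' i) :
    partWeight p G a j = partWeight p G a' j := by
  funext v
  unfold partWeight
  congr 1
  refine Finset.sum_congr rfl fun i _ => ?_
  rw [part_congr fun k hk => h k (hk.trans_lt i.2)]

theorem partWeight_nonneg (j : ℕ) (v : Fin n) : 0 ≤ partWeight p G a j v := by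
  unfold partWeight; positivity

theorem degInto_le (v : Fin n) (I : Finset (Fin n)) : degInto G v I ≤ n :=
  (Finset.card_le_univ _).trans_eq (Fintype.card_fin n)

theorem sum_degInto (I : Finset (Fin n)) : ∑ v, degInto G v I = degSum G I := by
  have h1 : ∀ v, degInto G v I = ∑ y ∈ I, if G.Adj v y then 1 else 0 := by
    intro v
    rw [degInto, ← Finset.card_filter]
    congr 1; ext y; simp [and_comm]
  have h2 : ∀ v, degInto G v Finset.univ = ∑ y, if G.Adj y v then 1 else 0 := by
    intro v
    rw [degInto, ← Finset.card_filter]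
    congr 1; ext y; simp [G.adj_comm]
  simp only [h1, degSum, h2]
  rw [Finset.sum_comm]

theorem degSum_univ : degSum G Finset.univ = G.arcCount := by
  have h : ∀ v, degInto G v Finset.univ = ∑ y, if G.Adj v y then 1 else 0 := by
    intro v
    rw [degInto, ← Finset.card_filter]
    congr 1; ext y; simp
  rw [SimpleGraph.arcCount, Finset.card_filter, Fintype.sum_prod_type, degSum]
  exact Finset.sum_congr rfl fun v _ => h v

theorem sum_partWeight_le (j : ℕ) : ∑ v, partWeight p G a j v ≤ j + 1 := by
  have h : ∀ I, ∑ v, (degInto G v I : ℝ) / degSum G I ≤ 1 := by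
    intro I
    rw [← Finset.sum_div, ← Nat.cast_sum, sum_degInto]
    exact div_self_le_one _
  simp only [partWeight, Finset.sum_add_distrib]
  rw [Finset.sum_comm]
  have : ∑ i : Fin j, ∑ v, (degInto G v (part p G a i) : ℝ) / degSum G (part p G a i) ≤
      ∑ i : Fin j, (1 : ℝ) := Finset.sum_le_sum fun i _ => h _
  simp only [Finset.sum_const, Finset.card_univ, Fintype.card_fin, nsmul_eq_mul, mul_one] at this
  linarith [h Finset.univ]

theorem degSum_part_le (hp : 0 < p) (j : ℕ) :
    (degSum G (part p G a j) : ℝ) ≤ G.arcCount * (j + 1) / p + n := by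
  rw [degSum, part_eq]
  have := sum_cell_le (p := p) (w := partWeight p G a j) (partWeight_nonneg j) hp
    (f := fun v => degInto G v Finset.univ) (fun v => degInto_le v _) (fun v => by
      rw [sum_degInto]
      unfold partWeight
      exact le_add_of_nonneg_right (by positivity)) (sum_partWeight_le j) (a j)
  rwa [sum_degInto, degSum_univ] at this

theorem degInto_div_le_partWeight {i j : ℕ} (hij : i < j) (v : Fin n) :
    (degInto G v (part p G a i) : ℝ) / degSum G (part p G a i) ≤ partWeight p G a j v := by
  have h : ∀ k ∈ (Finset.univ : Finset (Fin j)),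
      0 ≤ (degInto G v (part p G a k) : ℝ) / degSum G (part p G a k) := fun k _ => by positivity
  have := Finset.single_le_sum h (Finset.mem_univ (⟨i, hij⟩ : Fin j))
  unfold partWeight
  exact this.trans (le_add_of_nonneg_left (by positivity))

theorem sum_degInto_part_le (hp : 0 < p) {i j : ℕ} (hij : i < j) :
    ((∑ v ∈ part p G a j, degInto G v (part p G a i) : ℕ) : ℝ) ≤
      degSum G (part p G a i) * (j + 1) / p + n := by
  have hw : ∀ v, ((degInto G v (part p G a i) : ℕ) : ℝ) /
      ((∑ x, degInto G x (part p G a i) : ℕ) : ℝ) ≤ partWeight p G a j v := fun v => by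
    rw [sum_degInto]
    exact degInto_div_le_partWeight hij v
  have := sum_cell_le (p := p) (w := partWeight p G a j) (partWeight_nonneg j) hp
    (f := fun v => degInto G v (part p G a i)) (fun v => degInto_le v _) hw
      (sum_partWeight_le j) (a j)
  rwa [sum_degInto, ← part_eq j] at this

/-- Two balancing steps, each gaining a factor `p` up to `L`: part `i` is balanced for degrees, and
part `j` for the number of neighbours in part `i`. The denominators are cleared. -/
theorem sum_degInto_part_mul_le (hp : 0 < p) {i j L : ℕ} (hij : i < j) (hj : j < L) :
    (∑ v ∈ part p G a j, degInto G v (part p G a i)) * p ^ 2 ≤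
      G.arcCount * L ^ 2 + (L + 1) * n * p ^ 2 := by
  have hp' : (1 : ℝ) ≤ p := by exact_mod_cast hp
  have h1 := degSum_part_le (a := a) (G := G) hp i
  have h2 := sum_degInto_part_le (a := a) (G := G) hp hij
  have hj' : (j : ℝ) + 1 ≤ L := by exact_mod_cast hj
  have hi' : (i : ℝ) + 1 ≤ L := by
    have : i + 1 ≤ L := by omega
    exact_mod_cast this
  set X : ℝ := ((∑ v ∈ part p G a j, degInto G v (part p G a i) : ℕ) : ℝ)
  set Y : ℝ := ((degSum G (part p G a i) : ℕ) : ℝ)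
  have hY : Y * p ≤ G.arcCount * L + n * p := by
    have h3 : Y * p ≤ (G.arcCount * (i + 1) / p + n) * p :=
      mul_le_mul_of_nonneg_right h1 (by positivity)
    rw [add_mul, div_mul_cancel₀ _ (by positivity)] at h3
    have : (G.arcCount : ℝ) * (i + 1) ≤ G.arcCount * L :=
      mul_le_mul_of_nonneg_left hi' (by positivity)
    linarith
  have hX : X * p ≤ Y * L + n * p := by
    have h3 : X * p ≤ (Y * (j + 1) / p + n) * p := mul_le_mul_of_nonneg_right h2 (by positivity)
    rw [add_mul, div_mul_cancel₀ _ (by positivity)] at h3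
    have : Y * (j + 1) ≤ Y * L := mul_le_mul_of_nonneg_left hj' (by positivity)
    linarith
  have : X * p ^ 2 ≤ G.arcCount * L ^ 2 + (L + 1) * n * p ^ 2 := by
    calc X * p ^ 2 = X * p * p := by ring
      _ ≤ (Y * L + n * p) * p := mul_le_mul_of_nonneg_right hX (by positivity)
      _ = Y * p * L + n * p ^ 2 := by ring
      _ ≤ (G.arcCount * L + n * p) * L + n * p ^ 2 := by gcongr
      _ ≤ (G.arcCount * L + n * p ^ 2) * L + n * p ^ 2 := by
        gcongr
        nlinarith
      _ = G.arcCount * L ^ 2 + (L + 1) * n * p ^ 2 := by ring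
  simp only [X] at this
  exact_mod_cast this

theorem mem_part_of_mem_of_mem {j : ℕ} {x y z : Fin n} (hx : x ∈ part p G a j)
    (hz : z ∈ part p G a j) (hxy : x ≤ y) (hyz : y ≤ z) : y ∈ part p G a j := by
  rw [part_eq, Finset.mem_filter] at hx hz ⊢
  refine ⟨Finset.mem_univ _, le_antisymm ?_ ?_⟩
  · exact (cell_mono (partWeight_nonneg j) hyz).trans_eq hz.2
  · exact hx.2.symm.le.trans (cell_mono (partWeight_nonneg j) hxy)

-- The branch is built level by level: part `j` depends on `a` only up to `j`, so `a j` may be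
-- chosen as the cell of `x j`.
variable (p G) in
theorem exists_forall_mem_part (hp : 0 < p) (x : ℕ → Fin n) (L : ℕ) :
    ∃ a : ℕ → ℕ, (∀ i, a i < p) ∧ ∀ i < L, x i ∈ part p G a i := by
  induction L with
  | zero => exact ⟨fun _ => 0, fun _ => hp, fun i hi => absurd hi (Nat.not_lt_zero i)⟩
  | succ L ih =>
    obtain ⟨a, ha, hx⟩ := ih
    have hne : ∀ c i, i < L → Function.update a L c i = a i := fun c i hi =>
      Function.update_of_ne hi.ne _ _
    refine ⟨Function.update a L (cell p (partWeight p G a L) (x L)), fun i => ?_, fun i hi => ?_⟩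
    · rcases eq_or_ne i L with rfl | h
      · rw [Function.update_self]; exact cell_lt hp _
      · rw [Function.update_of_ne h]; exact ha i
    · rcases Nat.lt_succ_iff_lt_or_eq.1 hi with h | rfl
      · rw [part_congr (a' := a) fun k hk => hne _ k (hk.trans_lt h)]
        exact hx i h
      · rw [part_eq, partWeight_congr (a' := a) fun k hk => hne _ k hk]
        simp

/-- Extend a finite branch of the tree of partitions by zeros. -/
def extendBranch {L p : ℕ} (a : Fin L → Fin p) (i : ℕ) : ℕ :=
  if h : i < L then a ⟨i, h⟩ else 0

/-- Once the earlier coordinates are fixed, `x` determines `a i` and `y` determines `a j`. So two of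
the `L` coordinates are redundant, and overwriting them arbitrarily is injective. -/
theorem card_branches_mul_le {L i j : ℕ} (hij : i < j) (hj : j < L) (x y : Fin n) :
    (Finset.univ.filter fun a : Fin L → Fin p => x ∈ part p G (extendBranch a) i ∧
      y ∈ part p G (extendBranch a) j).card * p ^ 2 ≤ p ^ L := by
  set S := Finset.univ.filter fun a : Fin L → Fin p => x ∈ part p G (extendBranch a) i ∧
      y ∈ part p G (extendBranch a) j
  let i' : Fin L := ⟨i, hij.trans hj⟩
  let j' : Fin L := ⟨j, hj⟩
  have hne : i' ≠ j' := fun h => hij.ne (congrArg Fin.val h)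
  have hval : ∀ {v : Fin n} {k : ℕ} (hk : k < L) (a : Fin L → Fin p),
      v ∈ part p G (extendBranch a) k → cell p (partWeight p G (extendBranch a) k) v =
        (a ⟨k, hk⟩).val := by
    intro v k hk a hv
    rw [part_eq, Finset.mem_filter] at hv
    rw [hv.2, extendBranch, dif_pos hk]
  have hpre : ∀ {k : ℕ} {a a' : Fin L → Fin p}, (∀ m : Fin L, m.val < k → a m = a' m) →
      ∀ m < k, extendBranch a m = extendBranch a' m := by
    intro k a a' h m hm
    unfold extendBranch
    split_ifs with hL
    · rw [h ⟨m, hL⟩ hm]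
    · rfl
  have huniq : ∀ a ∈ S, ∀ a' ∈ S, (∀ m, m ≠ i' → m ≠ j' → a m = a' m) → a = a' := by
    intro a ha a' ha' h
    simp only [S, Finset.mem_filter, Finset.mem_univ, true_and] at ha ha'
    have hi : a i' = a' i' := by
      refine Fin.ext ?_
      rw [← hval i'.2 a ha.1, ← hval i'.2 a' ha'.1, partWeight_congr]
      refine hpre fun m hm => h m ?_ ?_
      · rintro rfl; exact lt_irrefl _ hm
      · rintro rfl; exact lt_asymm hij hm
    have hj : a j' = a' j' := by
      refine Fin.ext ?_
      rw [← hval j'.2 a ha.2, ← hval j'.2 a' ha'.2, partWeight_congr]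
      refine hpre fun m hm => ?_
      by_cases hmi : m = i'
      · rw [hmi, hi]
      · refine h m hmi ?_
        rintro rfl; exact lt_irrefl _ hm
    funext m
    by_cases hmi : m = i'
    · rw [hmi, hi]
    · by_cases hmj : m = j'
      · rw [hmj, hj]
      · exact h m hmi hmj
  have hinj : (S ×ˢ (Finset.univ : Finset (Fin p × Fin p))).card ≤
      (Finset.univ : Finset (Fin L → Fin p)).card := by
    refine Finset.card_le_card_of_injOn
      (fun q => Function.update (Function.update q.1 i' q.2.1) j' q.2.2)
      (fun _ _ => Finset.mem_coe.2 (Finset.mem_univ _)) ?_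
    rintro ⟨a, b, c⟩ hq ⟨a', b', c'⟩ hq' heq
    simp only [Finset.coe_product, Set.mem_prod, Finset.mem_coe] at hq hq'
    have hc : c = c' := by
      have := congrFun heq j'
      simpa using this
    have hb : b = b' := by
      have := congrFun heq i'
      simpa [Function.update_of_ne hne] using this
    have ha : a = a' := huniq a hq.1 a' hq'.1 fun m hm hm' => by
      have := congrFun heq m
      simpa [Function.update_of_ne hm, Function.update_of_ne hm'] using this
    rw [ha, hb, hc]
  rw [Finset.card_product, Finset.card_univ, Finset.card_univ, Fintype.card_prod,
    Fintype.card_fun, Fintype.card_fin, Fintype.card_fin] at hinj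
  rwa [pow_two]

end Parts

end CongestedClique

namespace CongestedClique

open Classical

variable {n b : ℕ}

/-! ### Preparation: degrees and an even distribution of the arcs -/

section Setup

/-- The arcs that start at `x`. -/
noncomputable def arcsAt (G : SimpleGraph (Fin n)) (x : Fin n) : Finset (Fin n × Fin n) :=
  Finset.univ.filter fun e => e.1 = x ∧ G.Adj e.1 e.2

/-- The arcs are dealt out to the nodes in a round robin fashion. -/
noncomputable def holder (G : SimpleGraph (Fin n)) (e : Fin n × Fin n) : Option (Fin n) :=
  if G.Adj e.1 e.2 then
    some ⟨seqIndex (arcsAt G) e.1 e % n, Nat.mod_lt _ e.1.pos⟩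
  else none

variable {G : SimpleGraph (Fin n)}

theorem mem_arcsAt {e : Fin n × Fin n} (he : G.Adj e.1 e.2) : e ∈ arcsAt G e.1 := by
  simp [arcsAt, he]

theorem card_arcsAt (x : Fin n) : (arcsAt G x).card = degInto G x Finset.univ := by
  refine Finset.card_bij (fun e _ => e.2) ?_ ?_ ?_
  · intro e he
    simp only [arcsAt, Finset.mem_filter, Finset.mem_univ, true_and, and_true] at he ⊢
    exact he.1 ▸ he.2
  · intro e he e' he' h
    simp only [arcsAt, Finset.mem_filter, Finset.mem_univ, true_and] at he he'
    exact Prod.ext (he.1.trans he'.1.symm) h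
  · intro y hy
    simp only [Finset.mem_filter, Finset.mem_univ, true_and, and_true] at hy
    exact ⟨(x, y), by simp [arcsAt, hy], rfl⟩

theorem sum_card_arcsAt : ∑ x, (arcsAt G x).card = G.arcCount := by
  simp only [card_arcsAt]
  exact degSum_univ

theorem holder_eq_some {e : Fin n × Fin n} {h : Fin n} :
    holder G e = some h ↔ G.Adj e.1 e.2 ∧ seqIndex (arcsAt G) e.1 e % n = h.val := by
  unfold holder
  split_ifs with he
  · simp [he, Fin.ext_iff]
  · simp [he]

theorem holder_ne_none {e : Fin n × Fin n} : holder G e ≠ none ↔ G.Adj e.1 e.2 := by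
  unfold holder
  split_ifs with he <;> simp [he]

theorem seqIndex_arcsAt_inj {e e' : Fin n × Fin n} (he : G.Adj e.1 e.2) (he' : G.Adj e'.1 e'.2)
    (h : seqIndex (arcsAt G) e.1 e = seqIndex (arcsAt G) e'.1 e') : e = e' :=
  seqIndex_inj (mem_arcsAt he) (mem_arcsAt he') h

theorem card_holder_le (h : Fin n) :
    (Finset.univ.filter fun e => holder G e = some h).card ≤ G.arcCount / n + 1 := by
  refine card_le_of_mod_eq (fun e => seqIndex (arcsAt G) e.1 e) (o := 0) (n := n) (r := h.val)
    ?_ ?_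
  · intro e he e' he' heq
    simp only [Finset.coe_filter, Finset.mem_univ, true_and, Set.mem_ofPred_eq,
      holder_eq_some] at he he'
    exact seqIndex_arcsAt_inj he.1 he'.1 heq
  · intro e he
    simp only [Finset.mem_filter, Finset.mem_univ, true_and, holder_eq_some] at he
    refine ⟨Nat.zero_le _, ?_, he.2⟩
    have h1 := seqIndex_lt_total (mem_arcsAt he.1)
    rw [sum_card_arcsAt] at h1
    have h2 : G.arcCount < (G.arcCount / n + 1) * n := by
      rw [add_mul, one_mul]; exact Nat.lt_div_mul_add h.pos
    omega

/-- What the nodes know after the preparation: their neighbours, all degrees, and the arcs that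
were dealt to them. -/
structure IsPrepared (P : Set (SimpleGraph (Fin n))) (K : Fin n → Setoid (SimpleGraph (Fin n))) :
    Prop where
  neighborSet : ∀ v, Knows P (K v) (fun G => G.neighborSet v)
  degree : ∀ u v, Knows P (K u) (fun G => degInto G v Finset.univ)
  held : ∀ h, Knows P (K h) (fun G => {e | holder G e = some h})

variable {P Q : Set (SimpleGraph (Fin n))} {K K' : Fin n → Setoid (SimpleGraph (Fin n))}

theorem IsPrepared.mono (h : IsPrepared P K) (hQ : Q ⊆ P) (hK : ∀ v, K' v ≤ K v) :
    IsPrepared Q K' :=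
  ⟨fun v => ((h.neighborSet v).mono (hK v)).anti hQ,
    fun u v => ((h.degree u v).mono (hK u)).anti hQ,
    fun v => ((h.held v).mono (hK v)).anti hQ⟩

theorem Knows.degInto {s : Setoid (SimpleGraph (Fin n))} {v : Fin n}
    {I : SimpleGraph (Fin n) → Finset (Fin n)} (hN : Knows P s (fun G => G.neighborSet v))
    (hI : Knows P s I) : Knows P s (fun G => degInto G v (I G)) := by
  refine (hN.comp₂ hI fun N I => (Finset.univ.filter fun y => y ∈ N ∧ y ∈ I).card).congr
    fun G _ => ?_
  simp only [SimpleGraph.mem_neighborSet, CongestedClique.degInto]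

/-- The message sizes that occur. The largest is a routed item, namely an arc with the node it is
meant for, together with its optional next position. -/
theorem pow_bounds (hb : (n + 1) ^ 4 ≤ 2 ^ b) :
    n + 1 ≤ 2 ^ b ∧ (n + 1) * (n + 1) ≤ 2 ^ b ∧ n * n + 1 ≤ 2 ^ b ∧ n * n * n + 1 ≤ 2 ^ b ∧
      n * n * n * (n + 1) + 1 ≤ 2 ^ b := by
  have h4 : n * n * n * (n + 1) + 1 ≤ (n + 1) ^ 4 := by
    have : (n + 1) ^ 4 = n * n * n * (n + 1) + 1 + (3 * n ^ 3 + 6 * n ^ 2 + 4 * n) := by ring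
    omega
  have h3 : n * n * n ≤ n * n * n * (n + 1) := Nat.le_mul_of_pos_right _ (Nat.succ_pos n)
  have h2 : n * n ≤ n * n * n := by
    rcases Nat.eq_zero_or_pos n with rfl | h
    · simp
    · exact Nat.le_mul_of_pos_right _ h
  have h1 : (n + 1) * (n + 1) ≤ (n + 1) ^ 4 := by
    rw [← pow_two]; exact Nat.pow_le_pow_right (Nat.succ_pos n) (by norm_num)
  have h0 : n + 1 ≤ (n + 1) * (n + 1) := Nat.le_mul_of_pos_right _ (Nat.succ_pos n)
  omega

/-- After the degrees are announced, every node can number its own arcs globally. They are at most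
`n` consecutive numbers, so dealing them out modulo `n` takes one more round. -/
theorem exists_reach_isPrepared (hb : (n + 1) ^ 4 ≤ 2 ^ b)
    (hN : ∀ v, Knows P (K v) (fun G => G.neighborSet v)) :
    ∃ K', Reach b P 2 K K' ∧ IsPrepared P K' := by
  obtain ⟨hb1, -, hb2, -, -⟩ := pow_bounds hb
  obtain ⟨K₁, hr₁, hK₁⟩ := exists_reach_round_nat (P := P) (K := K) hb1
    (fun u _ G => degInto G u Finset.univ) (fun u _ G _ => Nat.lt_succ_of_le (degInto_le u _))
    (fun u _ => (hN u).degInto (Knows.const _))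
  have hadj : ∀ {G G' : SimpleGraph (Fin n)} {h : Fin n}, G.neighborSet h = G'.neighborSet h →
      ∀ y, G.Adj h y ↔ G'.Adj h y := fun hn y => Set.ext_iff.1 hn y
  obtain ⟨K₂, hr₂, hK₂⟩ := exists_reach_deliver (P := P) (K := K₁) (b := b)
    (ι := Fin n × Fin n) (δ := Unit) (by simpa using hb2) 1
    (fun G e => if G.Adj e.1 e.2 then some e.1 else none) holder (fun _ _ => ())
    (fun G _ e he => by
      by_contra h
      rw [← ne_eq, holder_ne_none] at h
      simp [h] at he)
    (fun h G hG G' hG' hr => by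
      have hn := hadj ((hr₁.knows (hN h)) hG hG' hr)
      have hd : ∀ v, (arcsAt G v).card = (arcsAt G' v).card := fun v => by
        rw [card_arcsAt, card_arcsAt]; exact hK₁ v h hG hG' hr
      have ha : arcsAt G h = arcsAt G' h := by
        ext ⟨x, y⟩
        simp only [arcsAt, Finset.mem_filter, Finset.mem_univ, true_and]
        exact and_congr_right fun hx => by subst hx; exact hn y
      funext ⟨x, y⟩
      by_cases hx : x = h
      · subst hx
        have hs : seqIndex (arcsAt G) x (x, y) = seqIndex (arcsAt G') x (x, y) := by
          unfold seqIndex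
          rw [ha]
          simp only [hd]
        simp only [holding, holder, hn y, hs]
      · have h1 : ∀ G : SimpleGraph (Fin n),
            (if G.Adj x y then some x else none) ≠ some h := by
          intro G; split_ifs
          · simpa using hx
          · simp
        simp only [holding, if_neg (h1 _)])
    (fun G hG h q => by
      refine card_le_of_mod_eq (fun e => seqIndex (arcsAt G) e.1 e)
        (o := ∑ h' ∈ Finset.univ.filter (· < h), (arcsAt G h').card) (n := n) (r := q.val) ?_ ?_
      · intro e he e' he' heq
        simp only [Finset.coe_filter, Finset.mem_univ, true_and, Set.mem_ofPred_eq,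
          holder_eq_some] at he he'
        exact seqIndex_arcsAt_inj he.2.1 he'.2.1 heq
      · intro e he
        simp only [Finset.mem_filter, Finset.mem_univ, true_and, holder_eq_some] at he
        obtain ⟨h1, h2, h3⟩ := he
        rw [if_pos h2, Option.some.injEq] at h1
        subst h1
        have h4 := seqIndex_lt (mem_arcsAt h2)
        have h5 : (arcsAt G e.1).card ≤ 1 * n := by
          rw [card_arcsAt, one_mul]; exact degInto_le _ _
        refine ⟨?_, by omega, h3⟩
        unfold seqIndex; omega)
  exact ⟨K₂, hr₁.trans hr₂, fun v => (hr₁.trans hr₂).knows (hN v),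
    fun u v => hr₂.knows (hK₁ v u), fun h => knows_holding_unit_iff.1 (hK₂ h)⟩

end Setup

/-! ### Collecting the whole graph -/

section Gather

variable {P : Set (SimpleGraph (Fin n))} {K : Fin n → Setoid (SimpleGraph (Fin n))} {d : ℕ}

theorem exists_reach_gather (hb : (n + 1) ^ 4 ≤ 2 ^ b) (hK : IsPrepared P K)
    (hd : ∀ G ∈ P, G.arcCount = d) :
    ∃ K', Reach b P (d / n + 1) K K' ∧ ∀ v, Knows P (K' v) (fun G => G) := by
  obtain ⟨-, -, -, hb3, -⟩ := pow_bounds hb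
  obtain ⟨K', hr, hK'⟩ := exists_reach_deliver (P := P) (K := K) (b := b)
    (ι := (Fin n × Fin n) × Fin n) (δ := Unit) (by simpa using hb3) (d / n + 1)
    (fun G e => holder G e.1) (fun G e => if G.Adj e.1.1 e.1.2 then some e.2 else none)
    (fun _ _ => ())
    (fun G _ e he => by
      by_contra h
      have : G.Adj e.1.1 e.1.2 := by by_contra h'; simp [h'] at h
      exact holder_ne_none.2 this he)
    (fun h => ((hK.held h).comp fun A (e : (Fin n × Fin n) × Fin n) =>
        if e.1 ∈ A then some ((), some e.2) else none).congr fun G _ => by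
      funext e
      simp only [Set.mem_ofPred_eq, holding]
      split_ifs with h1 h2
      · rfl
      · exact absurd (holder_eq_some.1 h1).1 h2
      · rfl)
    (fun G hG h q => by
      rw [← hd G hG]
      refine le_trans ?_ (card_holder_le (G := G) h)
      refine Finset.card_le_card_of_injOn Prod.fst ?_ ?_
      · intro e he
        simp only [Finset.coe_filter, Finset.mem_univ, true_and, Set.mem_ofPred_eq] at he ⊢
        exact he.1
      · intro e he e' he' heq
        simp only [Finset.coe_filter, Finset.mem_univ, true_and, Set.mem_ofPred_eq] at he he'
        have h1 : e.2 = q := by have := he.2; split_ifs at this; simpa using this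
        have h2 : e'.2 = q := by have := he'.2; split_ifs at this; simpa using this
        exact Prod.ext heq (h1.trans h2.symm))
  refine ⟨K', hr, fun v G hG G' hG' hrel => ?_⟩
  have h := knows_holding_unit_iff.1 (hK' v) hG hG' hrel
  ext x y
  have := Set.ext_iff.1 h ((x, y), v)
  simpa using this

end Gather

/-! ### Computing the tree of partitions -/

section Partition

variable {P : Set (SimpleGraph (Fin n))} {K : Fin n → Setoid (SimpleGraph (Fin n))}

/-- The interval from `q.1` to `q.2`, the right end excluded. -/
noncomputable def decodeInterval (q : Fin (n + 1) × Fin (n + 1)) : Finset (Fin n) :=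
  Finset.univ.filter fun v => q.1.val ≤ v.val ∧ v.val < q.2.val

/-- The end points of an interval. -/
noncomputable def encodeInterval (I : Finset (Fin n)) : Fin (n + 1) × Fin (n + 1) :=
  if h : ∃ q, decodeInterval q = I then h.choose else (0, 0)

theorem decode_encodeInterval {I : Finset (Fin n)}
    (hI : ∀ x ∈ I, ∀ z ∈ I, ∀ y, x ≤ y → y ≤ z → y ∈ I) :
    decodeInterval (encodeInterval I) = I := by
  have hex : ∃ q, decodeInterval q = I := by
    rcases I.eq_empty_or_nonempty with rfl | hne
    · exact ⟨(0, 0), by simp [decodeInterval]⟩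
    · refine ⟨((I.min' hne).castSucc, (I.max' hne).succ), ?_⟩
      ext v
      simp only [decodeInterval, Finset.mem_filter, Finset.mem_univ, true_and, Fin.val_castSucc,
        Fin.val_succ, Nat.lt_succ_iff]
      constructor
      · rintro ⟨h1, h2⟩
        exact hI _ (I.min'_mem hne) _ (I.max'_mem hne) v h1 h2
      · exact fun hv => ⟨I.min'_le v hv, I.le_max' v hv⟩
  rw [encodeInterval, dif_pos hex]
  exact hex.choose_spec

/-- Two rounds per level: the node `u` in charge of the branch `τ u` announces its next part, which
is an interval and so fits in one message, and every node replies with its number of neighbours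
there. These numbers are the weights needed for the next level. -/
theorem exists_reach_parts (hb : (n + 1) ^ 4 ≤ 2 ^ b) (hK : IsPrepared P K) (p : ℕ)
    (τ : Fin n → ℕ → ℕ) (L : ℕ) :
    ∃ K', Reach b P (2 * L) K K' ∧
      (∀ h u, ∀ i < L, Knows P (K' h) (fun G => part p G (τ u) i)) ∧
      ∀ u v, ∀ i < L, Knows P (K' u) (fun G => degInto G v (part p G (τ u) i)) := by
  obtain ⟨hb1, hb2, -, -, -⟩ := pow_bounds hb
  induction L with
  | zero => exact ⟨K, Reach.refl, fun _ _ _ h => absurd h (Nat.not_lt_zero _),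
      fun _ _ _ h => absurd h (Nat.not_lt_zero _)⟩
  | succ L ih =>
    obtain ⟨K₁, hr₁, hA, hB⟩ := ih
    have hpart : ∀ u, Knows P (K₁ u) (fun G => part p G (τ u) L) := by
      intro u G hG G' hG' hr
      have hw : partWeight p G (τ u) L = partWeight p G' (τ u) L := by
        have hdeg : ∀ v, degInto G v Finset.univ = degInto G' v Finset.univ :=
          fun v => hr₁.knows (hK.degree u v) hG hG' hr
        funext v
        unfold partWeight degSum
        simp only [hdeg]
        congr 1
        refine Finset.sum_congr rfl fun i _ => ?_
        have h1 : part p G (τ u) i = part p G' (τ u) i := hA u u i i.2 hG hG' hr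
        have h2 : degInto G v (part p G (τ u) i) = degInto G' v (part p G' (τ u) i) :=
          hB u v i i.2 hG hG' hr
        rw [h2, h1]
      simp only [part_eq, hw]
    obtain ⟨K₂, hr₂, hK₂⟩ := exists_reach_round (P := P) (K := K₁) (b := b)
      (M := Fin (n + 1) × Fin (n + 1)) (by simpa using hb2)
      (fun u _ G => encodeInterval (part p G (τ u) L)) (fun u _ => (hpart u).comp _)
    have hpart' : ∀ h u, Knows P (K₂ h) (fun G => part p G (τ u) L) := fun h u =>
      ((hK₂ u h).comp decodeInterval).congr fun G _ => decode_encodeInterval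
        fun x hx z hz y hxy hyz => mem_part_of_mem_of_mem hx hz hxy hyz
    obtain ⟨K₃, hr₃, hK₃⟩ := exists_reach_round_nat (P := P) (K := K₂) hb1
      (fun v u G => degInto G v (part p G (τ u) L))
      (fun v _ G _ => Nat.lt_succ_of_le (degInto_le v _))
      (fun v u => Knows.degInto ((hr₁.trans hr₂).knows (hK.neighborSet v)) (hpart' v u))
    refine ⟨K₃, (hr₁.trans (hr₂.trans hr₃)).mono (by omega), fun h u i hi => ?_,
      fun u v i hi => ?_⟩
    · rcases Nat.lt_succ_iff_lt_or_eq.1 hi with hi | rfl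
      · exact (hr₂.trans hr₃).knows (hA h u i hi)
      · exact hr₃.knows (hpart' h u)
    · rcases Nat.lt_succ_iff_lt_or_eq.1 hi with hi | rfl
      · exact (hr₂.trans hr₃).knows (hB u v i hi)
      · exact hK₃ v u

end Partition

end CongestedClique

namespace CongestedClique

open Classical

variable {n b : ℕ}

/-! ### Cycles inside a branch -/

section BranchGraph

variable {p L : ℕ} {G : SimpleGraph (Fin n)} {a : ℕ → ℕ}

/-- The pair `e` goes from an earlier part to a later part of the branch `a`. -/
def IsBranchPair (p L : ℕ) (G : SimpleGraph (Fin n)) (a : ℕ → ℕ) (e : Fin n × Fin n) : Prop :=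
  ∃ i j, i < j ∧ j < L ∧ e.1 ∈ part p G a i ∧ e.2 ∈ part p G a j

/-- The edges of `G` between different levels of the branch `a`. -/
def branchGraph (p L : ℕ) (G : SimpleGraph (Fin n)) (a : ℕ → ℕ) : SimpleGraph (Fin n) where
  Adj x y := (G.Adj x y ∧ IsBranchPair p L G a (x, y)) ∨ (G.Adj y x ∧ IsBranchPair p L G a (y, x))
  symm := ⟨fun _ _ h => h.symm⟩
  loopless := ⟨fun x h => h.elim (fun h => G.loopless.irrefl x h.1)
    fun h => G.loopless.irrefl x h.1⟩

theorem branchGraph_le : branchGraph p L G a ≤ G := fun _ _ h =>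
  h.elim (fun h => h.1) fun h => h.1.symm

theorem card_branchPair_mul_le (hp : 0 < p) :
    (Finset.univ.filter fun e => G.Adj e.1 e.2 ∧ IsBranchPair p L G a e).card * p ^ 2 ≤
      L ^ 2 * (G.arcCount * L ^ 2 + (L + 1) * n * p ^ 2) := by
  let S : ℕ × ℕ → Finset (Fin n × Fin n) := fun q => Finset.univ.filter fun e =>
    G.Adj e.1 e.2 ∧ q.1 < q.2 ∧ q.2 < L ∧ e.1 ∈ part p G a q.1 ∧ e.2 ∈ part p G a q.2
  have hsub : (Finset.univ.filter fun e => G.Adj e.1 e.2 ∧ IsBranchPair p L G a e) ⊆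
      (Finset.range L ×ˢ Finset.range L).biUnion S := by
    intro e he
    obtain ⟨-, h1, i, j, h2, h3, h4⟩ := Finset.mem_filter.1 he
    simp only [Finset.mem_biUnion, Finset.mem_product, Finset.mem_range, S, Finset.mem_filter,
      Finset.mem_univ, true_and]
    exact ⟨(i, j), ⟨h2.trans h3, h3⟩, h1, h2, h3, h4⟩
  have hS : ∀ q, (S q).card * p ^ 2 ≤ G.arcCount * L ^ 2 + (L + 1) * n * p ^ 2 := by
    rintro ⟨i, j⟩
    by_cases hij : i < j ∧ j < L
    · refine le_trans (Nat.mul_le_mul_right _ ?_)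
        (sum_degInto_part_mul_le (a := a) (G := G) hp hij.1 hij.2)
      have : S (i, j) ⊆ (part p G a j).biUnion fun v =>
          (Finset.univ.filter fun y => G.Adj v y ∧ y ∈ part p G a i).image fun y => (y, v) := by
        rintro ⟨x, y⟩ he
        simp only [S, Finset.mem_filter, Finset.mem_univ, true_and] at he
        simp only [Finset.mem_biUnion, Finset.mem_image, Finset.mem_filter, Finset.mem_univ,
          true_and, Prod.mk.injEq]
        exact ⟨y, he.2.2.2.2, x, ⟨he.1.symm, he.2.2.2.1⟩, rfl, rfl⟩
      refine (Finset.card_le_card this).trans (Finset.card_biUnion_le.trans ?_)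
      exact Finset.sum_le_sum fun v _ => Finset.card_image_le
    · have : S (i, j) = ∅ := by
        refine Finset.filter_eq_empty_iff.2 fun e _ he => hij ⟨he.2.1, he.2.2.1⟩
      rw [this]; simp
  calc _ ≤ (∑ q ∈ Finset.range L ×ˢ Finset.range L, (S q).card) * p ^ 2 :=
        Nat.mul_le_mul_right _ ((Finset.card_le_card hsub).trans Finset.card_biUnion_le)
    _ = ∑ q ∈ Finset.range L ×ˢ Finset.range L, (S q).card * p ^ 2 := Finset.sum_mul _ _ _
    _ ≤ ∑ q ∈ Finset.range L ×ˢ Finset.range L, (G.arcCount * L ^ 2 + (L + 1) * n * p ^ 2) :=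
        Finset.sum_le_sum fun q _ => hS q
    _ = _ := by simp [pow_two]

theorem card_branches_of_pair_mul_le (e : Fin n × Fin n) :
    (Finset.univ.filter fun a : Fin L → Fin p =>
      IsBranchPair p L G (extendBranch a) e).card * p ^ 2 ≤ L ^ 2 * p ^ L := by
  let S : ℕ × ℕ → Finset (Fin L → Fin p) := fun q => Finset.univ.filter fun a =>
    q.1 < q.2 ∧ q.2 < L ∧ e.1 ∈ part p G (extendBranch a) q.1 ∧
      e.2 ∈ part p G (extendBranch a) q.2
  have hsub : (Finset.univ.filter fun a : Fin L → Fin p =>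
      IsBranchPair p L G (extendBranch a) e) ⊆ (Finset.range L ×ˢ Finset.range L).biUnion S := by
    intro a ha
    obtain ⟨-, i, j, h2, h3, h4⟩ := Finset.mem_filter.1 ha
    simp only [Finset.mem_biUnion, Finset.mem_product, Finset.mem_range, S, Finset.mem_filter,
      Finset.mem_univ, true_and]
    exact ⟨(i, j), ⟨h2.trans h3, h3⟩, h2, h3, h4⟩
  have hS : ∀ q, (S q).card * p ^ 2 ≤ p ^ L := by
    rintro ⟨i, j⟩
    by_cases hij : i < j ∧ j < L
    · refine le_trans (Nat.mul_le_mul_right _ (Finset.card_le_card fun a ha => ?_))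
        (card_branches_mul_le (G := G) hij.1 hij.2 e.1 e.2)
      simp only [S, Finset.mem_filter, Finset.mem_univ, true_and] at ha ⊢
      exact ha.2.2
    · have : S (i, j) = ∅ := by
        refine Finset.filter_eq_empty_iff.2 fun e _ he => hij ⟨he.1, he.2.1⟩
      rw [this]; simp
  calc _ ≤ (∑ q ∈ Finset.range L ×ˢ Finset.range L, (S q).card) * p ^ 2 :=
        Nat.mul_le_mul_right _ ((Finset.card_le_card hsub).trans Finset.card_biUnion_le)
    _ = ∑ q ∈ Finset.range L ×ˢ Finset.range L, (S q).card * p ^ 2 := Finset.sum_mul _ _ _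
    _ ≤ ∑ q ∈ Finset.range L ×ˢ Finset.range L, p ^ L := Finset.sum_le_sum fun q _ => hS q
    _ = _ := by simp [pow_two]

/-- Some branch of the tree of partitions sees a cycle of length at most `L`. -/
def SeesCycle (p L : ℕ) (G : SimpleGraph (Fin n)) : Prop :=
  ∃ a : Fin L → Fin p, (branchGraph p L G (extendBranch a)).egirth ≤ L

/-- The consecutive nodes of a shortest cycle lie in the consecutive parts of some branch.
Conversely, a branch graph is a subgraph of `G`. -/
theorem egirth_le_iff_seesCycle (hp : 0 < p) (hL : (L : ℕ∞) ≤ G.egirth) :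
    G.egirth ≤ L ↔ SeesCycle p L G := by
  constructor
  · intro hle
    have hG : G.egirth = L := le_antisymm hle hL
    have hac : ¬ G.IsAcyclic := fun h => by
      rw [← SimpleGraph.egirth_eq_top, hG] at h
      exact ENat.natCast_ne_top L h
    obtain ⟨u, w, hw, hlen⟩ := SimpleGraph.exists_egirth_eq_length.2 hac
    have hwL : w.length = L := by
      rw [hG] at hlen; exact_mod_cast hlen.symm
    have hL3 : 3 ≤ L := hwL ▸ hw.three_le_length
    obtain ⟨a, ha, hmem⟩ := exists_forall_mem_part p G hp w.getVert L
    let a' : Fin L → Fin p := fun i => ⟨a i, ha i⟩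
    have hmem' : ∀ i < L, w.getVert i ∈ part p G (extendBranch a') i := fun i hi => by
      rw [part_congr (a' := a) fun k hk => by
        simp [extendBranch, a', hk.trans_lt hi]]
      exact hmem i hi
    have hadj : ∀ i < L, (branchGraph p L G (extendBranch a')).Adj (w.getVert i)
        (w.getVert (i + 1)) := by
      intro i hi
      have hG' : G.Adj (w.getVert i) (w.getVert (i + 1)) := w.adj_getVert_succ (hwL ▸ hi)
      by_cases hi' : i + 1 < L
      · exact Or.inl ⟨hG', i, i + 1, Nat.lt_succ_self i, hi', hmem' i hi, hmem' _ hi'⟩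
      · have h0 : w.getVert (i + 1) = w.getVert 0 := by
          rw [show i + 1 = w.length by omega, SimpleGraph.Walk.getVert_length,
            SimpleGraph.Walk.getVert_zero]
        rw [h0] at hG' ⊢
        -- The closing edge joins the last level to level 0, so it is a branch pair only in the
        -- reverse direction.
        exact Or.inr ⟨hG'.symm, 0, i, by omega, hi, hmem' 0 (by omega), hmem' i hi⟩
    have hedges : ∀ e ∈ w.edges, e ∈ (branchGraph p L G (extendBranch a')).edgeSet := by
      intro e he
      obtain ⟨i, hi, rfl⟩ : ∃ i < w.length, e = s(w.getVert i, w.getVert (i + 1)) := by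
        obtain ⟨i, hi, hie⟩ := List.mem_iff_getElem.1 he
        exact ⟨i, w.length_edges ▸ hi,
          hie.symm.trans (SimpleGraph.Walk.getElem_edges hi)⟩
      exact hadj i (hwL ▸ hi)
    refine ⟨a', (SimpleGraph.egirth_le_length (hw.transfer hedges)).trans ?_⟩
    rw [SimpleGraph.Walk.length_transfer, hwL]
  · rintro ⟨a, ha⟩
    exact (SimpleGraph.egirth_anti branchGraph_le).trans ha

end BranchGraph

/-! ### Testing one cycle length -/

section Check

variable {P : Set (SimpleGraph (Fin n))} {K : Fin n → Setoid (SimpleGraph (Fin n))} {d p L : ℕ}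

/-- A bound for the number of items per node, divided by `n`, in the search for cycles of length
`L` in a graph with `d` arcs. -/
def checkLoad (n d L p : ℕ) : ℕ := L ^ 2 * (L ^ 2 * (d / (n * p ^ 2) + 1) + L + 1)

theorem lt_div_add_one_mul {k : ℕ} (d : ℕ) (hk : 0 < k) : d < (d / k + 1) * k := by
  rw [add_mul, one_mul]; exact Nat.lt_div_mul_add hk

theorem recv_le_checkLoad (hn : 0 < n) (hp : 0 < p) :
    L ^ 2 * (d * L ^ 2 + (L + 1) * n * p ^ 2) ≤ checkLoad n d L p * n * p ^ 2 := by
  have h := (lt_div_add_one_mul d (show 0 < n * p ^ 2 by positivity)).le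
  unfold checkLoad
  calc _ ≤ L ^ 2 * ((d / (n * p ^ 2) + 1) * (n * p ^ 2) * L ^ 2 + (L + 1) * n * p ^ 2) := by gcongr
    _ = _ := by ring

/-- A node holds at most `d / n + 1` arcs, each wanted by at most `L ^ 2 * p ^ (L - 2)` branches,
and `p ^ L ≤ n`. -/
theorem load_le_checkLoad (hn : 0 < n) (hp : 0 < p) (hL : 0 < L) (hpL : p ^ L ≤ n) :
    (d / n + 1) * (L ^ 2 * p ^ L) ≤ checkLoad n d L p * n * p ^ 2 := by
  have h := (lt_div_add_one_mul d (show 0 < n * p ^ 2 by positivity)).le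
  have h1 : d / n * n ≤ d := Nat.div_mul_le_self d n
  have hp2 : 1 ≤ p ^ 2 := Nat.one_le_pow _ _ hp
  have hL2 : 1 ≤ L ^ 2 := Nat.one_le_pow _ _ hL
  unfold checkLoad
  set q := d / (n * p ^ 2) + 1
  calc (d / n + 1) * (L ^ 2 * p ^ L) ≤ (d / n + 1) * (L ^ 2 * n) := by gcongr
    _ = L ^ 2 * (d / n * n + n) := by ring
    _ ≤ L ^ 2 * (L ^ 2 * (q * (n * p ^ 2)) + (L + 1) * (n * p ^ 2)) := by
        refine Nat.mul_le_mul_left _ (Nat.add_le_add ?_ ?_)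
        · exact (h1.trans h).trans (Nat.le_mul_of_pos_left _ hL2)
        · exact (Nat.le_mul_of_pos_right n hp2).trans (Nat.le_mul_of_pos_left _ (Nat.succ_pos L))
    _ = _ := by ring

/-- The number of rounds that are needed to find out whether a graph with `d` arcs and without
shorter cycles has a cycle of length `L`. -/
def checkRounds (n d L p : ℕ) : ℕ :=
  2 * L + Nat.clog 2 n * (3 * checkLoad n d L p + 2) + 1

theorem exists_reach_check (hb : (n + 1) ^ 4 ≤ 2 ^ b) (hn : 0 < n) (hK : IsPrepared P K)
    (hd : ∀ G ∈ P, G.arcCount = d) (hp : 0 < p) (hL : 0 < L) (hpL : p ^ L ≤ n) :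
    ∃ K', Reach b P (checkRounds n d L p) K K' ∧ ∀ v, Knows P (K' v) (SeesCycle p L) := by
  obtain ⟨hb1, -, -, -, hb4⟩ := pow_bounds hb
  obtain ⟨σ⟩ : Nonempty ((Fin L → Fin p) ↪ Fin n) :=
    Function.Embedding.nonempty_of_card_le (by simpa using hpL)
  -- Nodes without a branch take part with a dummy one; the condition `∃ a, σ a = e.2` in `pos`
  -- keeps arcs from being sent to them.
  let τ : Fin n → ℕ → ℕ := fun u =>
    if h : ∃ a, σ a = u then extendBranch h.choose else fun _ => 0
  have hτ : ∀ a, τ (σ a) = extendBranch a := by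
    intro a
    have hex : ∃ a', σ a' = σ a := ⟨a, rfl⟩
    simp only [τ, dif_pos hex]
    rw [σ.injective hex.choose_spec]
  obtain ⟨K₁, hr₁, hA, -⟩ := exists_reach_parts hb hK p τ L
  let pos : SimpleGraph (Fin n) → (Fin n × Fin n) × Fin n → Option (Fin n) := fun G e =>
    if (∃ a, σ a = e.2) ∧ IsBranchPair p L G (τ e.2) e.1 then holder G e.1 else none
  have hpos : ∀ {G e h}, pos G e = some h ↔
      ((∃ a, σ a = e.2) ∧ IsBranchPair p L G (τ e.2) e.1) ∧ holder G e.1 = some h := by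
    intro G e h
    simp only [pos]; split_ifs with hc <;> simp [hc]
  have hpos' : ∀ {G e}, pos G e ≠ none ↔
      ((∃ a, σ a = e.2) ∧ IsBranchPair p L G (τ e.2) e.1) ∧ G.Adj e.1.1 e.1.2 := by
    intro G e
    rw [← holder_ne_none]
    simp only [pos]; split_ifs with hc <;> simp [hc]
  have hpair : ∀ h, ∀ {G G'}, G ∈ P → G' ∈ P → (K₁ h).r G G' → ∀ u e,
      IsBranchPair p L G (τ u) e ↔ IsBranchPair p L G' (τ u) e := by
    intro h G G' hG hG' hr u e
    have hpt : ∀ i < L, part p G (τ u) i = part p G' (τ u) i := fun i hi => hA h u i hi hG hG' hr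
    unfold IsBranchPair
    refine exists_congr fun i => exists_congr fun j => and_congr_right fun hij =>
      and_congr_right fun hj => ?_
    rw [hpt i (hij.trans hj), hpt j hj]
  have hp2 : 0 < p ^ 2 := by positivity
  obtain ⟨K₂, hr₂, hK₂⟩ := exists_reach_route (P := P) (K := K₁) (b := b)
    (ι := (Fin n × Fin n) × Fin n) (dest := Prod.snd) (pos := pos) (M := checkLoad n d L p)
    (by simpa using hb4)
    (fun G hG h => by
      refine Nat.le_of_mul_le_mul_right ?_ hp2
      refine le_trans ?_ (load_le_checkLoad (d := d) hn hp hL hpL)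
      let H := Finset.univ.filter fun e => holder G e = some h
      let S : Fin n × Fin n → Finset (Fin L → Fin p) := fun e =>
        Finset.univ.filter fun a => IsBranchPair p L G (extendBranch a) e
      have hsub : (Finset.univ.filter fun e => pos G e = some h) ⊆
          H.biUnion fun e => (S e).image fun a => (e, σ a) := by
        rintro ⟨e, u⟩ he
        simp only [Finset.mem_filter, Finset.mem_univ, true_and, hpos] at he
        obtain ⟨⟨⟨a, rfl⟩, h1⟩, h2⟩ := he
        rw [hτ] at h1
        simp only [Finset.mem_biUnion, Finset.mem_image, H, S, Finset.mem_filter,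
          Finset.mem_univ, true_and]
        exact ⟨e, h2, a, h1, rfl⟩
      have hH : H.card ≤ d / n + 1 := hd G hG ▸ card_holder_le h
      calc _ ≤ (∑ e ∈ H, (S e).card) * p ^ 2 := by
            refine Nat.mul_le_mul_right _ ((Finset.card_le_card hsub).trans
              (Finset.card_biUnion_le.trans ?_))
            exact Finset.sum_le_sum fun e _ => Finset.card_image_le
        _ = ∑ e ∈ H, (S e).card * p ^ 2 := Finset.sum_mul _ _ _
        _ ≤ ∑ e ∈ H, L ^ 2 * p ^ L :=
            Finset.sum_le_sum fun e _ => card_branches_of_pair_mul_le e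
        _ = H.card * (L ^ 2 * p ^ L) := by rw [Finset.sum_const, smul_eq_mul]
        _ ≤ _ := Nat.mul_le_mul_right _ hH)
    (fun G hG u => by
      refine Nat.le_of_mul_le_mul_right ?_ hp2
      refine le_trans ?_ (recv_le_checkLoad (d := d) hn hp)
      rw [← hd G hG]
      refine le_trans (Nat.mul_le_mul_right _ ?_)
        (card_branchPair_mul_le (G := G) (a := τ u) (L := L) hp)
      refine Finset.card_le_card_of_injOn Prod.fst ?_ ?_
      · rintro ⟨e, u'⟩ he
        simp only [Finset.coe_filter, Finset.mem_univ, true_and, Set.mem_ofPred_eq, hpos'] at he ⊢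
        obtain ⟨⟨⟨-, h1⟩, h2⟩, rfl⟩ := he
        exact ⟨h2, h1⟩
      · intro e he e' he' heq
        simp only [Finset.coe_filter, Finset.mem_univ, true_and, Set.mem_ofPred_eq] at he he'
        exact Prod.ext heq (he.2.trans he'.2.symm))
    (fun h G hG G' hG' hr => by
      have hheld : {e | holder G e = some h} = {e | holder G' e = some h} :=
        hr₁.knows (hK.held h) hG hG' hr
      ext e
      simp only [Set.mem_ofPred_eq, hpos, hpair h hG hG' hr]
      exact and_congr_right fun _ => Set.ext_iff.1 hheld e.1)
  have hbit : ∀ u, Knows P (K₂ u) (fun G => decide ((∃ a, σ a = u) ∧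
      (branchGraph p L G (τ u)).egirth ≤ L)) := by
    intro u G hG G' hG' hr
    by_cases ha : ∃ a, σ a = u
    · have hset := hK₂ u hG hG' hr
      have hE : ∀ e, (G.Adj e.1 e.2 ∧ IsBranchPair p L G (τ u) e) ↔
          (G'.Adj e.1 e.2 ∧ IsBranchPair p L G' (τ u) e) := by
        intro e
        have := Set.ext_iff.1 hset (e, u)
        simp only [Set.mem_ofPred_eq, hpos', ha, true_and, and_true] at this
        rw [and_comm, this, and_comm]
      have : branchGraph p L G (τ u) = branchGraph p L G' (τ u) := by
        ext x y
        exact or_congr (hE (x, y)) (hE (y, x))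
      simp only [this]
    · simp [ha]
  obtain ⟨K₃, hr₃, hK₃⟩ := exists_reach_round (P := P) (K := K₂) (b := b) (M := Bool)
    (by simpa using (show 2 ≤ n + 1 by omega).trans hb1) (fun u _ G => decide ((∃ a, σ a = u) ∧
      (branchGraph p L G (τ u)).egirth ≤ L)) (fun u _ => hbit u)
  refine ⟨K₃, (hr₁.trans (hr₂.trans hr₃)).mono (by unfold checkRounds; omega), fun v => ?_⟩
  refine ((Knows.pi fun u => hK₃ u v).comp fun f => ∃ u, f u = true).congr fun G _ => ?_
  simp only [decide_eq_true_eq, SeesCycle, eq_iff_iff]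
  constructor
  · rintro ⟨_, ⟨a, rfl⟩, h⟩
    exact ⟨a, hτ a ▸ h⟩
  · rintro ⟨a, h⟩
    exact ⟨σ a, ⟨a, rfl⟩, (hτ a).symm ▸ h⟩

end Check

end CongestedClique

namespace CongestedClique

open Classical

variable {n b : ℕ}

/-! ### The search over all lengths -/

section Loop

/-- All graphs with `d` arcs have girth at most `L`. -/
def IsForced (n L d : ℕ) : Prop :=
  ∀ G : SimpleGraph (Fin n), G.arcCount = d → G.egirth ≤ L

/-- The integer part of the `L`-th root of `n`. -/
noncomputable def natRoot (n L : ℕ) : ℕ := ⌊(n : ℝ) ^ (1 / (L : ℝ))⌋₊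

theorem one_le_rpow_root (hn : 0 < n) (L : ℕ) : (1 : ℝ) ≤ (n : ℝ) ^ (1 / (L : ℝ)) :=
  Real.one_le_rpow (by exact_mod_cast hn) (by positivity)

theorem natRoot_pos (hn : 0 < n) (L : ℕ) : 0 < natRoot n L :=
  Nat.floor_pos.2 (one_le_rpow_root hn L)

theorem natRoot_pow_le {L : ℕ} (hL : L ≠ 0) : natRoot n L ^ L ≤ n := by
  have h0 : (0 : ℝ) ≤ (n : ℝ) ^ (1 / (L : ℝ)) := by positivity
  have h : ((natRoot n L : ℝ)) ^ L ≤ n := by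
    calc ((natRoot n L : ℝ)) ^ L ≤ ((n : ℝ) ^ (1 / (L : ℝ))) ^ L :=
          pow_le_pow_left₀ (Nat.cast_nonneg _) (Nat.floor_le h0) L
      _ = n := by
          rw [one_div, Real.rpow_inv_natCast_pow (Nat.cast_nonneg n) hL]
  exact_mod_cast h

theorem rpow_le_two_mul_natRoot (hn : 0 < n) (L : ℕ) :
    (n : ℝ) ^ (1 / (L : ℝ)) ≤ 2 * natRoot n L := by
  have h1 : (n : ℝ) ^ (1 / (L : ℝ)) < natRoot n L + 1 := Nat.lt_floor_add_one _
  have h2 : (1 : ℝ) ≤ natRoot n L := by exact_mod_cast natRoot_pos hn L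
  linarith

/-- Induction on the number `k` of stages still allowed; once it is used up, `L` exceeds `Nat.log 2
n` and the graph is collected. The budget `t G` only has to cover unforced lengths up to the girth
of `G`, as no others are tested. This makes the running time depend on the unknown girth. -/
theorem solves_of_isPrepared (hb : (n + 1) ^ 4 ≤ 2 ^ b) (hn : 0 < n) {d : ℕ}
    (t : SimpleGraph (Fin n) → ℕ) (k : ℕ) : ∀ (L : ℕ) (P : Set (SimpleGraph (Fin n)))
    (K : Fin n → Setoid (SimpleGraph (Fin n))), Nat.log 2 n + 1 ≤ L + k → 0 < L →
    IsPrepared P K → (∀ G ∈ P, G.arcCount = d) → (∀ G ∈ P, (L : ℕ∞) ≤ G.egirth) →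
    (∀ G ∈ P, ∀ M, L ≤ M → (M : ℕ∞) ≤ G.egirth → ¬ IsForced n M d → M ≤ Nat.log 2 n →
      checkRounds n d M (natRoot n M) ≤ t G) →
    (∀ G ∈ P, ∀ M, L ≤ M → (M : ℕ∞) ≤ G.egirth → ¬ IsForced n M d → Nat.log 2 n < M →
      d / n + 1 ≤ t G) →
    Solves b SimpleGraph.egirth P K (fun G => (k + 1) * t G) := by
  induction k with
  | zero =>
    intro L P K hLk hL hK hd hg _ ht
    by_cases hF : IsForced n L d
    · exact Solves.done fun v => (Knows.const (L : ℕ∞)).congr fun G hG =>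
        le_antisymm (hg G hG) (hF G (hd G hG))
    · obtain ⟨K', hr, hK'⟩ := exists_reach_gather hb hK hd
      refine (hr.2 _ (fun _ => 0) (Solves.done fun v => (hK' v).comp _)).mono fun G hG => ?_
      have := ht G hG L le_rfl (hg G hG) hF (by omega)
      omega
  | succ k ih =>
    intro L P K hLk hL hK hd hg ht ht'
    by_cases hF : IsForced n L d
    · exact Solves.done fun v => (Knows.const (L : ℕ∞)).congr fun G hG =>
        le_antisymm (hg G hG) (hF G (hd G hG))
    by_cases hlog : Nat.log 2 n < L
    · obtain ⟨K', hr, hK'⟩ := exists_reach_gather hb hK hd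
      refine (hr.2 _ (fun _ => 0) (Solves.done fun v => (hK' v).comp _)).mono fun G hG => ?_
      have := ht' G hG L le_rfl (hg G hG) hF hlog
      nlinarith [Nat.zero_le ((k + 1) * t G)]
    obtain ⟨K', hr, hK'⟩ := exists_reach_check hb hn hK hd (natRoot_pos hn L) hL
      (natRoot_pow_le hL.ne')
    refine (hr.2 _ (fun G => (k + 1) * t G) ?_).mono fun G hG => ?_
    · refine Solves.cases (SeesCycle (natRoot n L) L) hK' fun c => ?_
      by_cases hc : c
      · refine Solves.done fun v => (Knows.const (L : ℕ∞)).congr fun G hG => ?_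
        have hs : SeesCycle (natRoot n L) L G := by rw [hG.2]; exact hc
        exact le_antisymm (hg G hG.1)
          ((egirth_le_iff_seesCycle (natRoot_pos hn L) (hg G hG.1)).2 hs)
      -- No branch sees a cycle, so the girth is at least `L + 1`.
      · refine ih (L + 1) _ K' (by omega) (Nat.succ_pos L)
          (hK.mono Set.inter_subset_left hr.1) (fun G hG => hd G hG.1) (fun G hG => ?_)
          (fun G hG M hM => ht G hG.1 M (by omega)) (fun G hG M hM => ht' G hG.1 M (by omega))
        have hs : ¬ SeesCycle (natRoot n L) L G := by rw [hG.2]; exact hc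
        rw [← egirth_le_iff_seesCycle (natRoot_pos hn L) (hg G hG.1), not_le] at hs
        exact_mod_cast Order.add_one_le_of_lt hs
    · have := ht G hG L le_rfl (hg G hG) hF (not_lt.1 hlog)
      calc _ ≤ (k + 1) * t G + t G := Nat.add_le_add_left this _
        _ = _ := by ring

/-- The start state depends only on the neighbourhood, so it can be computed from any input in `P`
with that neighbourhood. -/
theorem exists_cliqueAlgorithm_of_solves {P : Set (SimpleGraph (Fin n))} {Out : Type}
    {g : SimpleGraph (Fin n) → Out} {t : SimpleGraph (Fin n) → ℕ}
    (h : Solves b g P (fun v => Setoid.ker fun G => G.neighborSet v) t) :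
    ∃ A : CliqueAlgorithm n b Out, ∀ G ∈ P, ∃ T ≤ t G, A.ComputesWithin G (g G) T := by
  obtain ⟨A, st, hst, hrun⟩ := h
  let B : CliqueAlgorithm n b Out :=
    { A with init := fun v N =>
        if h : ∃ G, G ∈ P ∧ G.neighborSet v = N then st v h.choose else A.init v N }
  have hinit : ∀ G ∈ P, ∀ v, B.init v (G.neighborSet v) = st v G := by
    intro G hG v
    have hex : ∃ G', G' ∈ P ∧ G'.neighborSet v = G.neighborSet v := ⟨G, hG, rfl⟩
    simp only [B, dif_pos hex]
    exact hst v hex.choose_spec.1 hG hex.choose_spec.2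
  refine ⟨B, fun G hG => ?_⟩
  obtain ⟨T, hT, h⟩ := hrun G hG
  refine ⟨T, hT, fun v => ?_⟩
  rw [CliqueAlgorithm.run_eq_runFrom]
  simp only [hinit G hG]
  have hB : ∀ r v, B.runFrom (fun v => st v G) r v = A.runFrom (fun v => st v G) r v := by
    intro r
    induction r with
    | zero => exact fun _ => rfl
    | succ r ih =>
      intro v
      simp only [CliqueAlgorithm.runFrom, ih]
      rfl
  rw [hB]
  exact h v

theorem exists_cliqueAlgorithm_egirth (hb : (n + 1) ^ 4 ≤ 2 ^ b) (hn : 0 < n) (l : ℕ)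
    (t : SimpleGraph (Fin n) → ℕ)
    (ht : ∀ G : SimpleGraph (Fin n), (l : ℕ∞) < G.egirth → ∀ M, l < M → (M : ℕ∞) ≤ G.egirth →
      ¬ IsForced n M G.arcCount → M ≤ Nat.log 2 n →
      checkRounds n G.arcCount M (natRoot n M) ≤ t G)
    (ht' : ∀ G : SimpleGraph (Fin n), (l : ℕ∞) < G.egirth → ∀ M, l < M → (M : ℕ∞) ≤ G.egirth →
      ¬ IsForced n M G.arcCount → Nat.log 2 n < M → G.arcCount / n + 1 ≤ t G) :
    ∃ A : CliqueAlgorithm n b ℕ∞, ∀ G : SimpleGraph (Fin n), (l : ℕ∞) < G.egirth →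
      ∃ T ≤ (Nat.log 2 n + 1) * t G + 2, A.ComputesWithin G G.egirth T := by
  refine exists_cliqueAlgorithm_of_solves (P := {G | (l : ℕ∞) < G.egirth}) ?_
  obtain ⟨K, hr, hK⟩ := exists_reach_isPrepared (P := {G | (l : ℕ∞) < G.egirth})
    (K := fun v => Setoid.ker fun G => G.neighborSet v) hb (fun v G _ G' _ h => h)
  refine hr.2 _ _ ?_
  refine Solves.cases SimpleGraph.arcCount (fun v => ?_) fun d => ?_
  · refine ((Knows.pi fun u => hK.degree v u).comp fun f => ∑ u, f u).congr fun G _ => ?_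
    exact degSum_univ
  · refine solves_of_isPrepared hb hn t (Nat.log 2 n) (l + 1) _ K (by omega) (Nat.succ_pos l)
      (hK.mono Set.inter_subset_left fun _ => le_rfl) (fun G hG => hG.2) (fun G hG => ?_) ?_ ?_
    · have h : (l : ℕ∞) < G.egirth := hG.1
      exact_mod_cast Order.add_one_le_of_lt h
    · rintro G ⟨hG, rfl⟩ M hM
      exact ht G hG M hM
    · rintro G ⟨hG, rfl⟩ M hM
      exact ht' G hG M hM

end Loop

/-! ### The round complexity -/

section Analysis

theorem girthRounds_natCast (n x : ℕ) : girthRounds n (x : ℕ∞) =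
    (n : ℝ) ^ (1 / (((x - 1) / 2 : ℕ) : ℝ) - 2 / (2 * (((x - 1) / 2 : ℕ) : ℝ) + 1)) := rfl

theorem girthRounds_top (n : ℕ) : girthRounds n ⊤ = 1 := rfl

theorem one_le_girthRounds (hn : 0 < n) {x : ℕ∞} (hx : 3 ≤ x) : 1 ≤ girthRounds n x := by
  induction x using ENat.recTopCoe with
  | top => exact (girthRounds_top n).ge
  | coe x =>
    have hx : 3 ≤ x := by exact_mod_cast hx
    rw [girthRounds_natCast]
    have hk : (1 : ℝ) ≤ (((x - 1) / 2 : ℕ) : ℝ) := by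
      have : 1 ≤ (x - 1) / 2 := by omega
      exact_mod_cast this
    refine Real.one_le_rpow (by exact_mod_cast hn) ?_
    rw [sub_nonneg, div_le_div_iff₀ (by positivity) (by positivity)]
    linarith

/-- At `k = j` the left side equals `1 / (j * (2 * j + 1))`, which decreases in `j`; a larger `k`
only lowers it. -/
theorem exponent_le_of_le {i j k : ℝ} (hi : 0 < i) (hij : i ≤ j) (hjk : j ≤ k) :
    1 / k - 2 / (2 * j + 1) ≤ 1 / i - 2 / (2 * i + 1) := by
  have hj : 0 < j := hi.trans_le hij
  have h1 : 1 / k ≤ 1 / j := one_div_le_one_div_of_le hj hjk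
  have h2 : 1 / j - 2 / (2 * j + 1) = 1 / (j * (2 * j + 1)) := by field_simp; ring
  have h3 : 1 / i - 2 / (2 * i + 1) = 1 / (i * (2 * i + 1)) := by field_simp; ring
  have h4 : 1 / (j * (2 * j + 1)) ≤ 1 / (i * (2 * i + 1)) :=
    one_div_le_one_div_of_le (by positivity) (by gcongr)
  linarith

/-- The bound of the theorem without its polylogarithmic factor. -/
noncomputable def girthBound (n l : ℕ) (G : SimpleGraph (Fin n)) : ℝ :=
  min (girthRounds n G.egirth) (girthRounds n ((2 * ((l + 1) / 2) + 1 : ℕ) : ℕ∞))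

variable {l L : ℕ} {G : SimpleGraph (Fin n)}

theorem one_le_girthBound (hn : 0 < n) (hl : 1 ≤ l) : 1 ≤ girthBound n l G := by
  refine le_min (one_le_girthRounds hn SimpleGraph.three_le_egirth) (one_le_girthRounds hn ?_)
  have : 3 ≤ 2 * ((l + 1) / 2) + 1 := by omega
  exact_mod_cast this

theorem arcCount_le (hn : 0 < n) {k : ℕ} (hk : k ≠ 0) (hG : (2 * k : ℕ) < G.egirth) {y : ℝ}
    (hy : (n : ℝ) ^ (1 / (k : ℝ)) ≤ y) : (G.arcCount : ℝ) / n ≤ 2 * (y + 1) := by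
  have h := SimpleGraph.arcCount_le_of_lt_egirth hk hG
  rw [Fintype.card_fin] at h
  have hn' : (0 : ℝ) < n := by exact_mod_cast hn
  rw [div_le_iff₀ hn']
  nlinarith

theorem exists_of_not_isForced {d : ℕ} (h : ¬ IsForced n L d) :
    ∃ G : SimpleGraph (Fin n), G.arcCount = d ∧ (L : ℕ∞) < G.egirth := by
  unfold IsForced at h
  push Not at h
  exact h

theorem rpow_one_div_le {k c : ℕ} (hk : k ≠ 0) (h : n ≤ c ^ k) :
    (n : ℝ) ^ (1 / (k : ℝ)) ≤ c := by
  have h1 : (n : ℝ) ≤ (c : ℝ) ^ k := by exact_mod_cast h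
  calc (n : ℝ) ^ (1 / (k : ℝ)) ≤ ((c : ℝ) ^ k) ^ (1 / (k : ℝ)) :=
        Real.rpow_le_rpow (Nat.cast_nonneg _) h1 (by positivity)
    _ = c := by rw [one_div, Real.pow_rpow_inv_natCast (Nat.cast_nonneg _) hk]

/-- A graph with the same number of arcs and girth above `L` exists. As `n ≤ 2 ^ L ≤ 8 ^ (L / 2)`,
the Moore bound gives at most `2 * (8 + 1) = 18` arcs per node. -/
theorem gather_le (hn : 0 < n) (hl : 1 ≤ l) (hL : l < L) (hF : ¬ IsForced n L G.arcCount)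
    (hlog : Nat.log 2 n < L) : ((G.arcCount / n + 1 : ℕ) : ℝ) ≤ 19 * girthBound n l G := by
  obtain ⟨G', hd, hG'⟩ := exists_of_not_isForced hF
  have hk : L / 2 ≠ 0 := by omega
  have hlt : n ≤ 8 ^ (L / 2) := by
    calc n ≤ 2 ^ (Nat.log 2 n + 1) := (Nat.lt_pow_succ_log_self one_lt_two n).le
      _ ≤ 2 ^ (3 * (L / 2)) := Nat.pow_le_pow_right two_pos (by omega)
      _ = 8 ^ (L / 2) := by rw [pow_mul]; norm_num
  have h1 := arcCount_le hn hk (lt_of_le_of_lt (by exact_mod_cast Nat.mul_div_le L 2) hG')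
    (rpow_one_div_le hk hlt)
  rw [hd] at h1
  have h2 : ((G.arcCount / n : ℕ) : ℝ) ≤ (G.arcCount : ℝ) / n := Nat.cast_div_le
  have h3 := one_le_girthBound (G := G) hn hl
  push_cast at h1 h2 ⊢
  linarith

theorem arcCount_div_le (hn : 0 < n) (hl : 1 ≤ l) (hL : l < L) (hLG : (L : ℕ∞) ≤ G.egirth)
    (hF : ¬ IsForced n L G.arcCount) :
    ((G.arcCount / (n * natRoot n L ^ 2) : ℕ) : ℝ) ≤ 24 * girthBound n l G := by
  have hn' : (0 : ℝ) < n := by exact_mod_cast hn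
  have hn1 : (1 : ℝ) ≤ n := by exact_mod_cast hn
  have hB := one_le_girthBound (G := G) hn hl
  have hp : (1 : ℝ) ≤ natRoot n L := by exact_mod_cast natRoot_pos hn L
  have hroot := rpow_le_two_mul_natRoot hn L
  have hr1 := one_le_rpow_root hn L
  have hL0 : (0 : ℝ) < L := by exact_mod_cast (show 0 < L by omega)
  set r : ℝ := (n : ℝ) ^ (2 / (L : ℝ))
  -- Rounding the root down loses at most a factor 2, hence 4 in the square.
  have hr : r ≤ 4 * (natRoot n L : ℝ) ^ 2 := by
    have : r = ((n : ℝ) ^ (1 / (L : ℝ))) ^ 2 := by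
      rw [← Real.rpow_natCast, ← Real.rpow_mul hn'.le]
      simp only [r]
      congr 1; push_cast; ring
    rw [this]
    nlinarith
  have hr0 : 1 ≤ r := Real.one_le_rpow hn1 (by positivity)
  have hq : ((G.arcCount / (n * natRoot n L ^ 2) : ℕ) : ℝ) ≤ 4 * (G.arcCount / n) / r := by
    refine Nat.cast_div_le.trans ?_
    push_cast
    rw [div_le_div_iff₀ (by positivity) (by positivity)]
    calc (G.arcCount : ℝ) * r ≤ G.arcCount * (4 * (natRoot n L : ℝ) ^ 2) := by gcongr
      _ = 4 * (G.arcCount / n) * (n * (natRoot n L : ℝ) ^ 2) := by field_simp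
  refine hq.trans ?_
  rw [div_le_iff₀ (by positivity)]
  -- For even `L` the Moore bound is applied to another graph with the same number of arcs and girth
  -- above `L`; for odd `L` it is applied to `G`.
  rcases Nat.even_or_odd' L with ⟨j, hj | hj⟩
  · obtain ⟨G', hd, hG'⟩ := exists_of_not_isForced hF
    have hrj : (n : ℝ) ^ (1 / (j : ℝ)) ≤ r := by
      refine le_of_eq ?_
      simp only [r, hj]
      congr 1
      push_cast
      rw [div_mul_eq_div_div]; norm_num
    have h := arcCount_le hn (k := j) (by omega) (by rw [← hj]; exact hG') hrj
    rw [hd] at h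
    nlinarith
  · have hj0 : j ≠ 0 := by omega
    have hj1 : (0 : ℝ) < j := by exact_mod_cast Nat.pos_of_ne_zero hj0
    have hjL : (L : ℝ) = 2 * j + 1 := by rw [hj]; push_cast; ring
    obtain ⟨g, hg⟩ | hg : (∃ g : ℕ, G.egirth = g) ∨ G.egirth = ⊤ := by
      rcases eq_or_ne G.egirth ⊤ with h | h
      · exact Or.inr h
      · obtain ⟨g, hg⟩ := ENat.ne_top_iff_exists.1 h
        exact Or.inl ⟨g, hg.symm⟩
    · have hgL : L ≤ g := by rw [hg] at hLG; exact_mod_cast hLG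
      set k := (g - 1) / 2
      have hjk : j ≤ k := by omega
      have hjk' : (j : ℝ) ≤ k := by exact_mod_cast hjk
      have hbound : (n : ℝ) ^ (1 / (k : ℝ)) / r ≤ girthBound n l G := by
        rw [← Real.rpow_sub hn', hjL]
        refine le_min ?_ ?_
        · rw [hg, girthRounds_natCast]
          refine Real.rpow_le_rpow_of_exponent_le hn1 ?_
          change 1 / (k : ℝ) - _ ≤ 1 / (k : ℝ) - 2 / (2 * (k : ℝ) + 1)
          gcongr
        · rw [girthRounds_natCast]
          refine Real.rpow_le_rpow_of_exponent_le hn1 ?_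
          have hi : (2 * ((l + 1) / 2) + 1 - 1) / 2 = (l + 1) / 2 := by omega
          rw [hi]
          refine exponent_le_of_le ?_ ?_ hjk'
          · exact_mod_cast (show 0 < (l + 1) / 2 by omega)
          · exact_mod_cast (show (l + 1) / 2 ≤ j by omega)
      rw [div_le_iff₀ (by positivity)] at hbound
      have h := arcCount_le (G := G) hn (k := k) (by omega) (by
        rw [hg]; exact_mod_cast (show 2 * k < g by omega)) hbound
      nlinarith
    -- For an acyclic graph every `k` is allowed. With `k = n` and `n ≤ 2 ^ n` there are at most 6
    -- arcs per node, which is where `24 = 4 * 6` comes from.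
    · have h := arcCount_le (G := G) hn (k := n) hn.ne' (by rw [hg]; exact ENat.natCast_lt_top _)
        (rpow_one_div_le hn.ne' (c := 2) Nat.lt_two_pow_self.le)
      push_cast at h
      nlinarith

theorem checkRounds_le (hn : 2 ≤ n) (hl : 1 ≤ l) (hL : l < L) (hLG : (L : ℕ∞) ≤ G.egirth)
    (hF : ¬ IsForced n L G.arcCount) (hlog : L ≤ Nat.log 2 n) :
    (checkRounds n G.arcCount L (natRoot n L) : ℝ) ≤
      86 * (Nat.clog 2 n : ℝ) ^ 5 * girthBound n l G := by
  have hB := one_le_girthBound (G := G) (by omega : 0 < n) hl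
  have hq := arcCount_div_le (by omega) hl hL hLG hF
  set q : ℝ := ((G.arcCount / (n * natRoot n L ^ 2) : ℕ) : ℝ)
  set B := girthBound n l G
  have hD : (1 : ℝ) ≤ (Nat.clog 2 n : ℝ) := by
    have := Nat.clog_pos one_lt_two hn
    exact_mod_cast this
  have hLD : (L : ℝ) ≤ (Nat.clog 2 n : ℝ) := by
    exact_mod_cast hlog.trans (Nat.log_le_clog 2 n)
  set D : ℝ := (Nat.clog 2 n : ℝ)
  have hq0 : 0 ≤ q := Nat.cast_nonneg _
  have hload : (checkLoad n G.arcCount L (natRoot n L) : ℝ) ≤ 27 * D ^ 4 * B := by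
    have : (checkLoad n G.arcCount L (natRoot n L) : ℝ) =
        (L : ℝ) ^ 2 * ((L : ℝ) ^ 2 * (q + 1) + L + 1) := by
      simp only [checkLoad, q]; push_cast; ring
    rw [this]
    have h2 : D ≤ D ^ 2 := by nlinarith
    have h3 : 1 ≤ D ^ 2 := by nlinarith
    calc (L : ℝ) ^ 2 * ((L : ℝ) ^ 2 * (q + 1) + L + 1)
        ≤ D ^ 2 * (D ^ 2 * (24 * B + B) + D ^ 2 * B + D ^ 2 * B) := by
          gcongr
          · exact hLD.trans (by nlinarith)
          · nlinarith
      _ = 27 * D ^ 4 * B := by ring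
  have h1 : D ≤ D ^ 5 := le_self_pow₀ hD (by norm_num)
  have h2 : 1 ≤ D ^ 5 := one_le_pow₀ hD
  have h3 : D ^ 5 ≤ D ^ 5 * B := le_mul_of_one_le_right (by positivity) hB
  calc (checkRounds n G.arcCount L (natRoot n L) : ℝ) =
        2 * L + D * (3 * checkLoad n G.arcCount L (natRoot n L) + 2) + 1 := by
        simp only [checkRounds, D]; push_cast; ring
    _ ≤ 2 * D + D * (3 * (27 * D ^ 4 * B) + 2) + 1 := by gcongr
    _ = 81 * (D ^ 5 * B) + 4 * D + 1 := by ring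
    _ ≤ 86 * D ^ 5 * B := by nlinarith

/-- From `(clog - 1) * log 2 ≤ log n` and `log 2 ≤ log n` the factor is `2 / log 2 < 3`. -/
theorem clog_le_three_mul_log (hn : 2 ≤ n) : (Nat.clog 2 n : ℝ) ≤ 3 * Real.log n := by
  have h1 : 2 ^ (Nat.clog 2 n - 1) < n := Nat.pow_pred_clog_lt_self one_lt_two (by omega)
  have hD : 1 ≤ Nat.clog 2 n := Nat.clog_pos one_lt_two hn
  have h2 : ((Nat.clog 2 n - 1 : ℕ) : ℝ) * Real.log 2 ≤ Real.log n := by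
    rw [← Real.log_pow]
    exact Real.log_le_log (by positivity) (by exact_mod_cast h1.le)
  rw [Nat.cast_sub hD] at h2
  have h3 : Real.log 2 ≤ Real.log n := Real.log_le_log two_pos (by exact_mod_cast hn)
  have h4 := Real.log_two_gt_d9
  push_cast at h2
  have h5 : (1 : ℝ) ≤ Nat.clog 2 n := by exact_mod_cast hD
  nlinarith

theorem succ_pow_four_le (hn : 2 ≤ n) : (n + 1) ^ 4 ≤ 2 ^ (8 * Nat.clog 2 n) := by
  calc (n + 1) ^ 4 ≤ (n ^ 2) ^ 4 := Nat.pow_le_pow_left (by nlinarith) 4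
    _ = n ^ 8 := by ring
    _ ≤ (2 ^ Nat.clog 2 n) ^ 8 := Nat.pow_le_pow_left (Nat.le_pow_clog one_lt_two n) 8
    _ = 2 ^ (8 * Nat.clog 2 n) := by rw [← pow_mul, mul_comm]

theorem exists_cliqueAlgorithm_of_two_le (hn : 2 ≤ n) (hl : 1 ≤ l) :
    ∃ A : CliqueAlgorithm n (8 * Nat.clog 2 n) ℕ∞, ∀ G : SimpleGraph (Fin n),
      (l : ℕ∞) < G.egirth → ∃ T : ℕ,
        (T : ℝ) ≤ 174 * 3 ^ 6 * Real.log n ^ 6 * girthBound n l G ∧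
          A.ComputesWithin G G.egirth T := by
  have hn0 : 0 < n := by omega
  have hD : (1 : ℝ) ≤ (Nat.clog 2 n : ℝ) := by
    have := Nat.clog_pos one_lt_two hn
    exact_mod_cast this
  have hlogD : ((Nat.log 2 n : ℕ) : ℝ) ≤ (Nat.clog 2 n : ℝ) := by
    exact_mod_cast Nat.log_le_clog 2 n
  have hDlog := clog_le_three_mul_log hn
  set D : ℝ := (Nat.clog 2 n : ℝ)
  have h5 : 1 ≤ D ^ 5 := one_le_pow₀ hD
  obtain ⟨A, hA⟩ := exists_cliqueAlgorithm_egirth (succ_pow_four_le hn) hn0 l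
    (fun G => ⌊86 * D ^ 5 * girthBound n l G⌋₊)
    (fun G _ M hM hMG hF hlog => Nat.le_floor (checkRounds_le hn hl hM hMG hF hlog))
    (fun G _ M hM _ hF hlog => Nat.le_floor ((gather_le hn0 hl hM hF hlog).trans (by
      have := one_le_girthBound (G := G) hn0 hl
      gcongr
      linarith)))
  refine ⟨A, fun G hG => ?_⟩
  obtain ⟨T, hT, hAT⟩ := hA G hG
  refine ⟨T, ?_, hAT⟩
  have hB := one_le_girthBound (G := G) hn0 hl
  set B := girthBound n l G
  have hfl : ((⌊86 * D ^ 5 * B⌋₊ : ℕ) : ℝ) ≤ 86 * D ^ 5 * B := Nat.floor_le (by positivity)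
  have hlog0 : (0 : ℝ) ≤ Real.log n := Real.log_natCast_nonneg n
  have h6 : 1 ≤ D ^ 6 * B := one_le_mul_of_one_le_of_one_le (one_le_pow₀ hD) hB
  calc (T : ℝ) ≤ ((Nat.log 2 n : ℕ) + 1) * (⌊86 * D ^ 5 * B⌋₊ : ℕ) + 2 := by exact_mod_cast hT
    -- There are at most `Nat.log 2 n + 1 ≤ 2 * D` stages, and two rounds of preparation.
    _ ≤ (D + D) * (86 * D ^ 5 * B) + 2 := by gcongr
    _ = 172 * (D ^ 6 * B) + 2 := by ring
    _ ≤ 174 * D ^ 6 * B := by linarith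
    _ ≤ 174 * (3 * Real.log n) ^ 6 * B := by gcongr
    _ = 174 * 3 ^ 6 * Real.log n ^ 6 * B := by ring

theorem exists_cliqueAlgorithm_of_lt_two (b : ℕ) (hn : n < 2) :
    ∃ A : CliqueAlgorithm n b ℕ∞, ∀ G : SimpleGraph (Fin n), A.ComputesWithin G G.egirth 0 := by
  refine ⟨⟨Unit, fun _ _ => (), fun _ _ => none, fun s _ => s, fun _ => some ⊤⟩, fun G v => ?_⟩
  have hG : G.egirth = ⊤ := by
    have : Subsingleton (Fin n) := Fin.subsingleton_iff_le_one.2 (by omega)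
    rw [Subsingleton.elim G ⊥, SimpleGraph.egirth_bot]
  rw [hG]

end Analysis

end CongestedClique

theorem mainTheorem4 :
    ∃ (B : ℕ) (C : ℝ) (c : ℕ), ∀ (n ℓ : ℕ), 1 ≤ ℓ →
      ∃ A : CliqueAlgorithm n (B * Nat.clog 2 n) ℕ∞,
        ∀ G : SimpleGraph (Fin n), (ℓ : ℕ∞) < G.egirth →
          ∃ T : ℕ,
            (T : ℝ) ≤ C * Real.log n ^ c *
              min (girthRounds n G.egirth)
                (girthRounds n ((2 * ((ℓ + 1) / 2) + 1 : ℕ) : ℕ∞)) ∧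
            A.ComputesWithin G G.egirth T := by
  refine ⟨8, 174 * 3 ^ 6, 6, fun n ℓ hℓ => ?_⟩
  rcases lt_or_ge n 2 with hn | hn
  · obtain ⟨A, hA⟩ := CongestedClique.exists_cliqueAlgorithm_of_lt_two (8 * Nat.clog 2 n) hn
    refine ⟨A, fun G _ => ⟨0, ?_, hA G⟩⟩
    have : Real.log n = 0 := by interval_cases n <;> simp
    rw [this]; simp
  · exact CongestedClique.exists_cliqueAlgorithm_of_two_le hn hℓ
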